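/- Conventions. Let $G$ be a finite abelian group and, for non-empty $X\subset G$, let $\mu_X$ be the uniform probability measure on $X$. A Bohr set $B$ is given by a finite set $\Gamma$ of characters of $G$ and widths $\delta_\gamma\in(0,2]$ $(\gamma\in\Gamma)$; its rank is $|\Gamma|$, and for $\rho>0$ its dilate is $B_\rho=\{x\in G: |1-\gamma(x)|\le \min(\rho\delta_\gamma,2)\ \text{for all}\ \gamma\in\Gamma\}$, with $B=B_1$. Write $\beta=\mu_B$, $\beta'=\mu_{B'}$, $\beta'''=\mu_{B'''}$. For real $d\ge 1$, $B$ is $d$-dimensional if $\mu_G(B_{2\rho})\le 2^d\mu_G(B_\rho)$ for all $\rho\in(0,1]$; it is then a $C$-regular $d$-dimensional Bohr set if $$\frac1{1+Cd|\eta|}\le\frac{\mu_G(B_{1+\eta})}{\mu_G(B)}\le 1+Cd|\eta|\qquad\text{whenever } |\eta|\le \frac1{Cd}.$$ When no dimension is named, $B$ is called $C$-regular if this holds for every $d\ge1$ for which $B$ is $d$-dimensional (equivalently, for the least such $d$). Convolution is $f*(g\,d\mu_X)(x)=\int f(x-y)g(y)\,d\mu_X(y)$. Corollary. There is an absolute constant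 $C_0>1$ such that for every $C_{\mathcal R}\ge C_0$ and every $K\ge1$ there are constants $c\in(0,1]$ and $C\ge1$, depending only on $C_{\mathcal R}$ and $K$, with the following property. Let $G$ be a finite abelian group, let $B$ be a $C_{\mathcal R}$-regular $d$-dimensional Bohr set in $G$, $d\ge1$, and let $B'\subset B_{\rho'}$, $\rho'>0$, be a Bohr set of rank $k\ge1$ that is $C_{\mathcal R}$-regular as a $d'$-dimensional Bohr set for some $1\le d'\le Kk$. Let $L,A\subset B$ have relative densities $\lambda=\beta(L)$, $\alpha=\beta(A)$ and let $S\subset B'$ have relative density $\sigma=\beta'(S)$. Suppose that $\rho'\le c\lambda\alpha/d$. Then either (1) $\displaystyle\langle 1_L*(1_S\,d\beta'),1_A\rangle_{L^2(\beta)}\ge \lambda\sigma\alpha/2$; or (2) there are a $C_{\mathcal R}$-regular Bohr set $B'''$ in $G$ and an integer $m\ge1$ with $$m\le C\lambda^{-2}\bigl(\log (2\lambda^{-1}\alpha^{-1})\bigr)^2\log(2\alpha^{-1})\log(2\sigma^{-1}),$$ $$\mathrm{rank}(B''')\le k+m,\qquad \mu_{B'}(B''')\ge\Bigl(\frac1{2km}\Bigr)^{C(k+m)},$$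 $$\|1_A*\beta'''\|_{L^\infty(\mu_G)}\ge\alpha(1+c\lambda).$$ -/

import Mathlib

noncomputable section

/-- The integral of `f` against the uniform probability measure on the non-empty set `X`,
that is `|X|⁻¹ ∑_{x ∈ X} f x`. -/
def uniformMean {G : Type*} [Fintype G] (X : Set G) (f : G → ℝ) : ℝ :=
  (∑ x : G, X.indicator f x) / (X.ncard : ℝ)

/-- The `{0, 1}`-valued indicator function of a set. -/
def ind {G : Type*} (X : Set G) : G → ℝ := X.indicator (fun _ => (1 : ℝ))

/-- The mass `μ_X(Y) = |Y ∩ X| / |X|` that the uniform probability measure on `X` gives to `Y`.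
For `Y ⊆ X` it is the relative density of `Y` in `X`; for `X = univ` it is Haar probability
measure. -/
def relDensity {G : Type*} [Fintype G] (X Y : Set G) : ℝ := uniformMean X (ind Y)

/-- The convolution `f ∗ (g dμ_X)`, that is `x ↦ ∫ f (x - y) g y dμ_X y`, with `μ_X` the uniform
probability measure on `X`. -/
def convOn {G : Type*} [AddCommGroup G] [Fintype G] (X : Set G) (f g : G → ℝ) : G → ℝ :=
  fun x => uniformMean X (fun y => f (x - y) * g y)

/-- The inner product of two real functions in `L²(μ_X)`. -/
def innerOn {G : Type*} [Fintype G] (X : Set G) (f g : G → ℝ) : ℝ :=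
  uniformMean X (fun x => f x * g x)

/-- The norm of `L^∞(μ_G)`; every point of the finite group has positive Haar measure, so it is
the maximum of `|f|`. -/
def supNorm {G : Type*} (f : G → ℝ) : ℝ := ⨆ x : G, |f x|

/-- The data of a Bohr set in a finite abelian group `G`: a set of characters (a homomorphism from
a finite group to the non-zero complex numbers has values on the unit circle) and a width in
`(0, 2]` for each of them. The values of `width` off the frequency set play no role. -/
structure BohrSet (G : Type*) [AddCommGroup G] where
  freq : Finset (AddChar G ℂ)
  width : AddChar G ℂ → ℝ
  width_pos : ∀ γ ∈ freq, 0 < width γ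
  width_le_two : ∀ γ ∈ freq, width γ ≤ 2

namespace BohrSet

/-- The rank is the number of frequencies. -/
def rank {G : Type*} [AddCommGroup G] (B : BohrSet G) : ℕ := B.freq.card

/-- The underlying set of points. -/
def carrier {G : Type*} [AddCommGroup G] (B : BohrSet G) : Set G :=
  {x | ∀ γ ∈ B.freq, ‖1 - γ x‖ ≤ B.width γ}

/-- The points of the dilate `B_ρ`, for `ρ > 0`: the Bohr set with the same frequencies and with
the widths `min (ρ δ_γ) 2`. -/
def dilate {G : Type*} [AddCommGroup G] (B : BohrSet G) (ρ : ℝ) : Set G :=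
  {x | ∀ γ ∈ B.freq, ‖1 - γ x‖ ≤ min (ρ * B.width γ) 2}

/-- `B` is `d`-dimensional. -/
def IsDimensional {G : Type*} [AddCommGroup G] [Fintype G] (B : BohrSet G) (d : ℝ) : Prop :=
  ∀ ρ : ℝ, 0 < ρ → ρ ≤ 1 →
    relDensity Set.univ (B.dilate (2 * ρ)) ≤ (2 : ℝ) ^ d * relDensity Set.univ (B.dilate ρ)

/-- `B` is a `C`-regular `d`-dimensional Bohr set. -/
def IsRegularOfDim {G : Type*} [AddCommGroup G] [Fintype G] (B : BohrSet G) (C d : ℝ) : Prop :=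
  B.IsDimensional d ∧
    ∀ η : ℝ, |η| ≤ 1 / (C * d) →
      1 / (1 + C * d * |η|) ≤
          relDensity Set.univ (B.dilate (1 + η)) / relDensity Set.univ (B.dilate 1) ∧
        relDensity Set.univ (B.dilate (1 + η)) / relDensity Set.univ (B.dilate 1) ≤
          1 + C * d * |η|

/-- `B` is `C`-regular, with no dimension specified: it is a `C`-regular `d`-dimensional Bohr set
for every `d ≥ 1` for which it is `d`-dimensional. Regularity becomes weaker as `d` grows, so this
is regularity for the least such `d`, the dimension of `B`. -/
def IsRegular {G : Type*} [AddCommGroup G] [Fintype G] (B : BohrSet G) (C : ℝ) : Prop :=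
  ∀ d : ℝ, 1 ≤ d → B.IsDimensional d → B.IsRegularOfDim C d

end BohrSet

end

/-! Let F(v), formalised as `shiftCorr`, be the sum over x in A of (1_L ∗ μ_S)(x + v). The inner
product is sig · F(0) / #B, so the aim is F(0) ≥ lam · #A / 2 unless some Bohr set carries a density
increment.

Croot–Sisask sampling (`exists_almost_periods`) gives a set T, of density at least (sig/2)^n / 2 in
a small dilate of B', such that F is nearly invariant under T - T. Averaging F over T - T l times
barely changes it, and damps by 4^(-l) every character at which the transform of μ_T is below 1/2. A
Chang-type theorem relative to Bohr sets (`card_le_of_dissociatedMod`, `exists_spectrum_control`)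
controls the remaining large spectrum by fewer than m characters. Narrowing B' and adjoining these
characters gives a Bohr set P on which every γ in the large spectrum is within lam / 60 of 1.

Suppose now that A has density at most al(1 + c lam) on every translate of P. This is used twice.
First (`exists_le_shiftCorr`), 1_A ∗ μ_P ∗ μ_{-S} has mass #A, is bounded by al(1 + c lam) and lives
on a set hardly larger than B. It therefore cannot avoid L, and F(t) is at least about 9/10 · lam ·
#A for some t in P. Second (`abs_shiftCorr_sub_le`), on the large spectrum the transform of 1_A is
at most twice that of 1_A ∗ μ_P, whose squared L² norm is at most 2 al · #A rather than #A. Hence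
the width lam / 60, with no power of al, already makes F(0) close to F(t). As lam⁻¹ ≤ m, the size of
P is then bounded below in terms of k and m alone.

Regular radii, needed at every scale, come from a rising-sun argument (`exists_regular_radius`). -/

open Finset

/-! ### Points of regular growth of a monotone counting function -/

open scoped Classical in
/-- A monotone real sequence grows faster than slope `c` to the right of few indices. -/
theorem card_steep_right_mul_le {N : ℕ} (g : ℕ → ℝ) (hg : Monotone g) {c : ℝ} (hc : 0 ≤ c) :
    ((#{i ∈ range N | ∃ j, i < j ∧ j ≤ N ∧ c * ((j : ℝ) - i) < g j - g i} : ℕ) : ℝ) * c ≤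
      g N - g 0 := by
  -- Rising-sun argument, inducting on the distance to `N`. From a steep index jump to its witness
  -- `j`: the `j - i` indices skipped are paid for by the rise `g j - g i`. From any other index
  -- move one step.
  have key : ∀ k i, i ≤ N → N - i = k →
      ((#{i' ∈ Ico i N | ∃ j, i' < j ∧ j ≤ N ∧ c * ((j : ℝ) - i') < g j - g i'} : ℕ) : ℝ) * c ≤
        g N - g i := by
    intro k
    induction k using Nat.strong_induction_on with
    | _ k ih =>
      intro i hi hk
      rcases hi.eq_or_lt with rfl | hlt
      · simp
      by_cases hb : ∃ j, i < j ∧ j ≤ N ∧ c * ((j : ℝ) - i) < g j - g i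
      · obtain ⟨j, hij, hjN, hj⟩ := hb
        have h1 := ih (N - j) (by omega) j hjN rfl
        have h2 : #{i' ∈ Ico i N | ∃ j, i' < j ∧ j ≤ N ∧ c * ((j : ℝ) - i') < g j - g i'} ≤
            (j - i) +
            #{i' ∈ Ico j N | ∃ j, i' < j ∧ j ≤ N ∧ c * ((j : ℝ) - i') < g j - g i'} := by
          rw [← Ico_union_Ico_eq_Ico hij.le hjN, filter_union]
          refine (card_union_le _ _).trans (add_le_add ?_ le_rfl)
          exact (card_filter_le _ _).trans (by simp)
        have h3 : ((#{i' ∈ Ico i N | ∃ j, i' < j ∧ j ≤ N ∧ c * ((j : ℝ) - i') < g j - g i'} : ℕ) : ℝ) ≤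
            ((j : ℝ) - i) +
            (#{i' ∈ Ico j N | ∃ j, i' < j ∧ j ≤ N ∧ c * ((j : ℝ) - i') < g j - g i'} : ℕ) := by
          have := (Nat.cast_le (α := ℝ)).2 h2
          rwa [Nat.cast_add, Nat.cast_sub hij.le] at this
        nlinarith [mul_le_mul_of_nonneg_right h3 hc]
      · have h1 := ih (N - (i + 1)) (by omega) (i + 1) hlt rfl
        have h2 : {i' ∈ Ico i N | ∃ j, i' < j ∧ j ≤ N ∧ c * ((j : ℝ) - i') < g j - g i'} =
            {i' ∈ Ico (i + 1) N | ∃ j, i' < j ∧ j ≤ N ∧ c * ((j : ℝ) - i') < g j - g i'} := by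
          rw [← insert_Ico_add_one_left_eq_Ico hlt, filter_insert, if_neg hb]
        rw [h2]
        exact h1.trans (by linarith [hg (Nat.le_succ i)])
  have := key N 0 (Nat.zero_le _) rfl
  rwa [← range_eq_Ico] at this

open scoped Classical in
/-- A monotone real sequence grows faster than slope `c` to the left of few indices. -/
theorem card_steep_left_mul_le {N : ℕ} (g : ℕ → ℝ) (hg : Monotone g) {c : ℝ} (hc : 0 ≤ c) :
    ((#((Icc 1 N).filter fun i : ℕ => ∃ j, j < i ∧ c * ((i : ℝ) - j) < g i - g j) : ℕ) : ℝ) * c ≤ g N - g 0 := by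
  -- The reflection `i ↦ N - i` exchanges left and right.
  have h := card_steep_right_mul_le (N := N) (fun i => -g (N - i))
    (fun a b hab => neg_le_neg (hg (by omega))) hc
  simp only [Nat.sub_zero, Nat.sub_self] at h
  have : #((Icc 1 N).filter fun i : ℕ => ∃ j, j < i ∧ c * ((i : ℝ) - j) < g i - g j) ≤
      #{i ∈ range N | ∃ j, i < j ∧ j ≤ N ∧ c * ((j : ℝ) - i) < -g (N - j) - -g (N - i)} := by
    refine card_le_card_of_injOn (fun i => N - i) ?_ ?_
    · intro i hi
      simp only [coe_filter, mem_Icc, Set.mem_ofPred_eq, mem_range] at hi ⊢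
      obtain ⟨⟨h1, h2⟩, j, hj, hlt⟩ := hi
      refine ⟨by omega, N - j, by omega, by omega, ?_⟩
      rw [Nat.sub_sub_self h2, Nat.sub_sub_self (hj.le.trans h2), Nat.cast_sub h2,
        Nat.cast_sub (hj.le.trans h2)]
      linarith
    · intro i hi j hj hij
      simp only [coe_filter, mem_Icc, Set.mem_ofPred_eq] at hi hj hij
      omega
  have h2 := mul_le_mul_of_nonneg_right ((Nat.cast_le (α := ℝ)).2 this) hc
  linarith

/-- Some index in the middle half is steep for neither of two monotone sequences. -/
theorem exists_flat_index {N : ℕ} (hN : 100 < N) (g F : ℕ → ℝ) (hg : Monotone g) (hF : Monotone F)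
    {c : ℝ} (hc0 : 0 < c) (hgN : g N - g 0 ≤ N / 16 * c) (hFN : F N - F 0 ≤ N / 100) :
    ∃ i ∈ Ioo (N / 4) (3 * N / 4),
      (∀ j, i < j → j ≤ N → g j - g i ≤ c * ((j : ℝ) - i)) ∧
      (∀ j, j < i → g i - g j ≤ c * ((i : ℝ) - j)) ∧
      (∀ j, i < j → j ≤ N → F j - F i ≤ 1 / 2 * ((j : ℝ) - i)) ∧
      (∀ j, j < i → F i - F j ≤ 1 / 2 * ((i : ℝ) - j)) := by
  classical
  have e1 := card_steep_right_mul_le (N := N) g hg hc0.le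
  have e2 := card_steep_left_mul_le (N := N) g hg hc0.le
  have e3 := card_steep_right_mul_le (N := N) F hF (c := 1 / 2) (by norm_num)
  have e4 := card_steep_left_mul_le (N := N) F hF (c := 1 / 2) (by norm_num)
  set b1 := {i ∈ range N | ∃ j, i < j ∧ j ≤ N ∧ c * ((j : ℝ) - i) < g j - g i}
  set b2 := ((Icc 1 N).filter fun i : ℕ => ∃ j, j < i ∧ c * ((i : ℝ) - j) < g i - g j)
  set b3 := {i ∈ range N | ∃ j, i < j ∧ j ≤ N ∧ (1 / 2 : ℝ) * ((j : ℝ) - i) < F j - F i}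
  set b4 := ((Icc 1 N).filter fun i : ℕ => ∃ j, j < i ∧ (1 / 2 : ℝ) * ((i : ℝ) - j) < F i - F j)
  have c1 : (#b1 : ℝ) ≤ N / 16 := le_of_mul_le_mul_right (by linarith) hc0
  have c2 : (#b2 : ℝ) ≤ N / 16 := le_of_mul_le_mul_right (by linarith) hc0
  have hN' : (100 : ℝ) < N := by exact_mod_cast hN
  have c3 : (#b3 : ℝ) ≤ N / 50 := by linarith
  have c4 : (#b4 : ℝ) ≤ N / 50 := by linarith
  -- The four bad sets have at most 2N/16 + 2N/50 elements in total, fewer than the middle half.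
  obtain ⟨i, hi, hib⟩ : ∃ i ∈ Ioo (N / 4) (3 * N / 4), i ∉ b1 ∪ b2 ∪ b3 ∪ b4 := by
    by_contra! hcon
    have h1 : #(Ioo (N / 4) (3 * N / 4)) ≤ #(b1 ∪ b2 ∪ b3 ∪ b4) := card_le_card hcon
    have h2 : #(b1 ∪ b2 ∪ b3 ∪ b4) ≤ #b1 + #b2 + #b3 + #b4 := by
      refine (card_union_le _ _).trans (add_le_add ?_ le_rfl)
      refine (card_union_le _ _).trans (add_le_add ?_ le_rfl)
      exact card_union_le _ _
    rw [Nat.card_Ioo] at h1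
    have h3 : N ≤ 2 * (#b1 + #b2 + #b3 + #b4) + 6 := by omega
    have h4 : (N : ℝ) ≤ 2 * (#b1 + #b2 + #b3 + #b4) + 6 := by exact_mod_cast h3
    linarith
  simp only [mem_union, not_or] at hib
  obtain ⟨⟨⟨n1, n2⟩, n3⟩, n4⟩ := hib
  have hi' := mem_Ioo.1 hi
  have hiN : i < N := by omega
  have hi1 : 1 ≤ i := by omega
  simp only [b1, b2, b3, b4, mem_filter, mem_range, mem_Icc, hiN, hi1, hiN.le, true_and, not_exists,
    not_and, not_lt] at n1 n2 n3 n4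
  exact ⟨i, hi, n1, n2, n3, n4⟩

set_option maxHeartbeats 1000000 in
/-- A monotone counting function of doubling exponent `d` has a point of regular growth in every
dyadic interval. -/
theorem exists_regular_radius (f : ℝ → ℕ) (hf : Monotone f) {r d : ℝ} (hr : 0 < r) (hd : 1 ≤ d)
    (hpos : 0 < f (r / 2)) (hdbl : (f r : ℝ) ≤ 2 ^ d * f (r / 2)) :
    ∃ ρ, r / 2 ≤ ρ ∧ ρ ≤ r ∧ ∀ η, 0 ≤ η → η ≤ 1 / (128 * d) →
      (f (ρ * (1 + η)) : ℝ) ≤ (1 + 128 * d * η) * f ρ ∧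
      (f ρ : ℝ) ≤ (1 + 128 * d * η) * f (ρ * (1 - η)) := by
  classical
  -- The grid is so fine that the integer-valued `f` itself rises by at most N/100 along it. This
  -- permits a slope condition on `f` besides the one on its logarithm.
  obtain ⟨N, hN⟩ : ∃ N : ℕ, 100 * (f r + 1) < N := ⟨_, Nat.lt_succ_self _⟩
  have hN0 : 0 < (N : ℝ) := by exact_mod_cast (by omega : 0 < N)
  have hNr : 100 * ((f r : ℝ) + 1) < N := by exact_mod_cast hN
  set h : ℝ := r / (2 * N) with hh
  have hh0 : 0 < h := by positivity
  have hhN : h * N = r / 2 := by rw [hh]; field_simp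
  let u : ℕ → ℝ := fun i => r / 2 + i * h
  have hu : Monotone u := fun a b hab => by
    have : (a : ℝ) ≤ b := by exact_mod_cast hab
    simp only [u]; nlinarith
  have hu0 : u 0 = r / 2 := by simp [u]
  have huN : u N = r := by simp only [u]; linarith
  let F : ℕ → ℝ := fun i => f (u i)
  have hF : Monotone F := fun a b hab => Nat.cast_le.2 (hf (hu hab))
  have hF0 : ∀ i, 0 < F i := fun i => Nat.cast_pos.2 (hpos.trans_le (hf (by
    rw [← hu0]; exact hu (Nat.zero_le _))))
  let g : ℕ → ℝ := fun i => Real.log (F i)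
  have hg : Monotone g := fun a b hab => Real.log_le_log (hF0 a) (hF hab)
  have hgN : g N - g 0 ≤ d := by
    have h1 : F N ≤ 2 ^ d * F 0 := by simpa [F, hu0, huN] using hdbl
    have h2 : g N ≤ Real.log (2 ^ d * F 0) := Real.log_le_log (hF0 N) h1
    rw [Real.log_mul (by positivity) (hF0 0).ne', Real.log_rpow (by norm_num)] at h2
    have := Real.log_two_lt_d9
    simp only [g] at h2 ⊢
    nlinarith
  have hFN : F N - F 0 ≤ f r := by
    have : F N = f r := by simp [F, huN]
    linarith [hF0 0]
  set c : ℝ := 16 * d / N with hc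
  have hc0 : 0 < c := by positivity
  obtain ⟨i, hi, n1, n2, n3, n4⟩ := exists_flat_index (N := N) (by omega) g F hg hF hc0
    (by rw [hc]; field_simp; linarith) (by linarith)
  rw [mem_Ioo] at hi
  have hiN : i < N := by omega
  have hi1 : 1 ≤ i := by omega
  have hi4 : (N : ℝ) ≤ 4 * i := by exact_mod_cast (by omega : N ≤ 4 * i)
  have hi34 : 4 * (i : ℝ) ≤ 3 * N := by exact_mod_cast (by omega : 4 * i ≤ 3 * N)
  have hiu : u i = r / 2 + i * h := rfl
  have hur : u i ≤ r := by rw [← huN]; exact hu hiN.le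
  have hur2 : r / 2 ≤ u i := by rw [← hu0]; exact hu (Nat.zero_le _)
  refine ⟨u i, hur2, hur, ?_⟩
  intro η hη0 hη1
  have hdη : 128 * d * η ≤ 1 := by
    rw [le_div_iff₀ (by positivity)] at hη1; linarith
  have hη2 : η ≤ 1 / 128 := by nlinarith
  have hη3 : u i * η ≤ r / 128 := by nlinarith
  have hexp : Real.exp (64 * d * η) ≤ 1 + 128 * d * η := by
    have hx : 0 ≤ 64 * d * η := by positivity
    have := Real.abs_exp_sub_one_sub_id_le (x := 64 * d * η) (by rw [abs_of_nonneg hx]; linarith)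
    rw [abs_le] at this
    nlinarith
  have hslope : ∀ k : ℕ, (k : ℝ) - 1 ≤ u i * η / h → 1 ≤ u i * η / h → c * k ≤ 64 * d * η := by
    intro k hk h1
    have h2 : (k : ℝ) ≤ 2 * (r * η / h) := by
      have : u i * η / h ≤ r * η / h := by gcongr
      linarith
    calc c * k ≤ c * (2 * (r * η / h)) := by gcongr
      _ = 64 * d * η := by rw [hc, hh]; field_simp; ring
  have hlog : ∀ a b : ℕ, g a - g b ≤ 64 * d * η → F a ≤ (1 + 128 * d * η) * F b := by
    intro a b hab
    have h1 : F a = Real.exp (g a - g b) * F b := by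
      simp only [g]
      rw [Real.exp_sub, Real.exp_log (hF0 a), Real.exp_log (hF0 b)]
      field_simp [(hF0 b).ne']
    rw [h1]
    exact mul_le_mul_of_nonneg_right ((Real.exp_le_exp.2 hab).trans hexp) (hF0 b).le
  have hnn : 0 ≤ u i * η / h := by
    have : 0 ≤ u i := le_trans (by positivity) hur2
    positivity
  have hceil := Nat.ceil_lt_add_one hnn
  have hceil2 := Nat.le_ceil (u i * η / h)
  set k := ⌈u i * η / h⌉₊ with hk
  have hkN : (k : ℝ) ≤ N / 4 := by
    have h1 : u i * η / h ≤ N / 64 := by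
      rw [div_le_iff₀ hh0]; nlinarith
    have h5 : (0 : ℝ) ≤ f r := Nat.cast_nonneg _
    linarith
  have hik : i + k ≤ N := by
    have : (i : ℝ) + k ≤ N := by linarith
    exact_mod_cast this
  have hki : k ≤ i := by
    have : (k : ℝ) ≤ i := by linarith
    exact_mod_cast this
  have hkh : u i * η ≤ k * h := by rwa [div_le_iff₀ hh0] at hceil2
  have up : (f (u i * (1 + η)) : ℝ) ≤ F (i + k) := by
    refine Nat.cast_le.2 (hf ?_)
    simp only [u] at hkh ⊢; push_cast; linarith
  have dn : F (i - k) ≤ (f (u i * (1 - η)) : ℝ) := by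
    refine Nat.cast_le.2 (hf ?_)
    simp only [u] at hkh ⊢; rw [Nat.cast_sub hki]; linarith
  have hone : 1 ≤ 1 + 128 * d * η := by nlinarith [mul_nonneg (by linarith : (0 : ℝ) ≤ d) hη0]
  -- If the displacement is at most one grid step, rounding up to the grid is too costly for the
  -- logarithmic slope. Instead slope at most 1/2 forces the integer-valued `F` to be constant on
  -- the neighbours of `i`. Otherwise rounding at most doubles the displacement and the logarithmic
  -- slope suffices.
  rcases le_or_gt k 1 with hk1 | hk1
  · have hstep : ∀ m n : ℕ, m ≤ n → F n - F m ≤ 1 / 2 → F n = F m := by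
      intro m n hmn hle
      have h1 : f (u m) ≤ f (u n) := hf (hu hmn)
      have h2 : (f (u n) : ℝ) < f (u m) + 1 := by simp only [F] at hle; linarith
      have h3 : f (u n) < f (u m) + 1 := by exact_mod_cast h2
      exact congrArg Nat.cast (by omega)
    have hup : F (i + 1) = F i := hstep _ _ (Nat.le_succ i) (by
      have := n3 (i + 1) (Nat.lt_succ_self _) hiN; push_cast at this; linarith)
    have hdn : F i = F (i - 1) := hstep _ _ (Nat.sub_le _ _) (by
      have := n4 (i - 1) (by omega); rw [Nat.cast_sub hi1] at this; push_cast at this; linarith)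
    constructor
    · calc (f (u i * (1 + η)) : ℝ) ≤ F (i + k) := up
        _ ≤ F (i + 1) := hF (by omega)
        _ = 1 * F i := by rw [hup, one_mul]
        _ ≤ _ := mul_le_mul_of_nonneg_right hone (hF0 i).le
    · calc (f (u i) : ℝ) = F (i - 1) := hdn
        _ ≤ F (i - k) := hF (by omega)
        _ = 1 * F (i - k) := by rw [one_mul]
        _ ≤ _ := mul_le_mul hone dn (hF0 _).le (by linarith)
  · have hge : 1 ≤ u i * η / h := by
      have : (2 : ℝ) ≤ k := by exact_mod_cast hk1
      linarith
    have hs := hslope k (by linarith) hge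
    constructor
    · refine up.trans (hlog _ _ ?_)
      have := n1 (i + k) (by omega) hik
      push_cast at this
      linarith
    · refine (hlog i (i - k) ?_).trans (mul_le_mul_of_nonneg_left dn (by linarith))
      have := n2 (i - k) (by omega)
      rw [Nat.cast_sub hki] at this
      linarith

/-! ### Fourier analysis and smoothing along T - T -/

/-- The Fourier transform of the uniform probability measure on `T`. -/
noncomputable def charMean {G : Type*} [AddCommGroup G] (T : Finset G) (γ : AddChar G ℂ) : ℂ :=
  (∑ y ∈ T, γ y) / #T

/-- The unnormalised Fourier transform of a function on a finite abelian group. -/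
noncomputable def fourierSum {G : Type*} [AddCommGroup G] [Fintype G] (f : G → ℂ)
    (γ : AddChar G ℂ) : ℂ :=
  ∑ x, f x * γ x

/-- The average of `f` over `v + T - T`. -/
noncomputable def diffMean {G : Type*} [AddCommGroup G] (T : Finset G) (f : G → ℂ) : G → ℂ :=
  fun v => (∑ y ∈ T, ∑ y' ∈ T, f (v + y - y')) / (#T : ℂ) ^ 2

theorem norm_diffMean_sub_le {G : Type*} [AddCommGroup G] {T : Finset G} (hT : T.Nonempty)
    {f g : G → ℂ} {e : ℝ} (v : G)
    (h : ∀ y ∈ T, ∀ y' ∈ T, ‖f (v + y - y') - g (v + y - y')‖ ≤ e) :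
    ‖diffMean T f v - diffMean T g v‖ ≤ e := by
  have hc : (0 : ℝ) < (#T : ℝ) ^ 2 := by have := hT.card_pos; positivity
  unfold diffMean
  rw [← sub_div, ← sum_sub_distrib, norm_div, norm_pow, RCLike.norm_natCast, div_le_iff₀ hc]
  simp only [← sum_sub_distrib]
  refine (norm_sum_le_of_le _ (fun y hy => norm_sum_le_of_le _ (h y hy))).trans (le_of_eq ?_)
  simp only [sum_const, nsmul_eq_mul]; ring

theorem diffMean_const {G : Type*} [AddCommGroup G] {T : Finset G} (hT : T.Nonempty) (a : ℂ) (v : G) :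
    diffMean T (fun _ => a) v = a := by
  have : (#T : ℂ) ≠ 0 := by simpa using hT.ne_empty
  simp only [diffMean, sum_const, nsmul_eq_mul]
  field_simp

section
variable {G : Type*} [AddCommGroup G] [Fintype G]

theorem AddChar.norm_one_sub_neg (γ : AddChar G ℂ) (x : G) : ‖1 - γ (-x)‖ = ‖1 - γ x‖ := by
  rw [AddChar.map_neg_eq_conj, ← Complex.norm_conj (1 - γ x)]
  simp

theorem AddChar.norm_one_sub_add_le (γ : AddChar G ℂ) (x y : G) :
    ‖1 - γ (x + y)‖ ≤ ‖1 - γ x‖ + ‖1 - γ y‖ := by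
  have : 1 - γ (x + y) = (1 - γ x) + γ x * (1 - γ y) := by rw [AddChar.map_add_eq_mul]; ring
  rw [this]
  refine (norm_add_le _ _).trans ?_
  rw [norm_mul, AddChar.norm_apply, one_mul]

theorem norm_charMean_le_one (T : Finset G) (γ : AddChar G ℂ) : ‖charMean T γ‖ ≤ 1 := by
  unfold charMean
  rw [norm_div, RCLike.norm_natCast]
  refine div_le_one_of_le₀ ?_ (Nat.cast_nonneg _)
  refine (norm_sum_le _ _).trans ?_
  simp

theorem fourierSum_inversion (f : G → ℂ) (t : G) :
    ∑ γ : AddChar G ℂ, fourierSum f γ * γ (-t) = Fintype.card G * f t := by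
  classical
  simp only [fourierSum, sum_mul]
  rw [sum_comm]
  have : ∀ x, ∑ γ : AddChar G ℂ, f x * γ x * γ (-t) = if x = t then Fintype.card G * f t else 0 := by
    intro x
    have h : ∀ γ : AddChar G ℂ, f x * γ x * γ (-t) = f x * γ (x - t) := fun γ => by
      rw [sub_eq_add_neg, AddChar.map_add_eq_mul]; ring
    simp only [h]
    rw [← mul_sum, AddChar.sum_apply_eq_ite]
    by_cases hx : x = t
    · simp [hx, mul_comm]
    · simp [hx, sub_eq_zero]
  simp [this]

theorem sum_norm_sq_fourierSum (f : G → ℂ) :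
    ∑ γ : AddChar G ℂ, ‖fourierSum f γ‖ ^ 2 = Fintype.card G * ∑ x, ‖f x‖ ^ 2 := by
  have h : ∀ γ : AddChar G ℂ, ((‖fourierSum f γ‖ ^ 2 : ℝ) : ℂ) =
      ∑ x, (starRingEnd ℂ) (f x) * (fourierSum f γ * γ (-x)) := by
    intro γ
    have : ((‖fourierSum f γ‖ ^ 2 : ℝ) : ℂ) =
        fourierSum f γ * (starRingEnd ℂ) (fourierSum f γ) := by
      rw [Complex.mul_conj, Complex.normSq_eq_norm_sq]
    rw [this]
    conv_lhs => rw [show (starRingEnd ℂ) (fourierSum f γ) =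
      ∑ x, (starRingEnd ℂ) (f x) * γ (-x) by
        simp [fourierSum, AddChar.map_neg_eq_conj]]
    rw [mul_sum]
    exact sum_congr rfl fun x _ => by ring
  have h2 : ((∑ γ : AddChar G ℂ, ‖fourierSum f γ‖ ^ 2 : ℝ) : ℂ) =
      ((Fintype.card G * ∑ x, ‖f x‖ ^ 2 : ℝ) : ℂ) := by
    rw [Complex.ofReal_sum]
    simp only [h]
    rw [sum_comm]
    push_cast
    rw [mul_sum]
    refine sum_congr rfl fun x _ => ?_
    rw [← mul_sum, fourierSum_inversion]
    have : (starRingEnd ℂ) (f x) * f x = (‖f x‖ : ℂ) ^ 2 := by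
      rw [mul_comm, Complex.mul_conj, Complex.normSq_eq_norm_sq]; push_cast; rfl
    linear_combination (Fintype.card G : ℂ) * this
  exact_mod_cast h2

theorem fourierSum_shift (f : G → ℂ) (γ : AddChar G ℂ) (s : G) :
    ∑ v, f (v + s) * γ v = γ (-s) * fourierSum f γ := by
  rw [fourierSum, mul_sum, ← Equiv.sum_comp (Equiv.addRight s) (fun x => γ (-s) * (f x * γ x))]
  refine sum_congr rfl fun v _ => ?_
  simp only [Equiv.coe_addRight, AddChar.map_add_eq_mul, AddChar.map_neg_eq_inv]
  have : γ s ≠ 0 := (γ.val_isUnit s).ne_zero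
  field_simp

/-- The multiplier is a squared modulus because the averaging measure is the convolution of μ_T with
its reflection. Its l-th iterate thus damps characters outside the 1/2-spectrum of T by 4^(-l). -/
theorem fourierSum_diffMean (T : Finset G) (f : G → ℂ) (γ : AddChar G ℂ) :
    fourierSum (diffMean T f) γ = (‖charMean T γ‖ ^ 2 : ℝ) * fourierSum f γ := by
  have h1 : ((‖charMean T γ‖ ^ 2 : ℝ) : ℂ) =
      (∑ y ∈ T, ∑ y' ∈ T, γ (-(y - y'))) / (#T : ℂ) ^ 2 := by
    have : ((‖charMean T γ‖ ^ 2 : ℝ) : ℂ) =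
        (starRingEnd ℂ) (charMean T γ) * charMean T γ := by
      rw [mul_comm, Complex.mul_conj, Complex.normSq_eq_norm_sq]
    rw [this, charMean, map_div₀, map_sum, Complex.conj_natCast, div_mul_div_comm, sum_mul_sum, sq]
    congr 1
    refine sum_congr rfl fun y _ => sum_congr rfl fun y' _ => ?_
    rw [neg_sub, sub_eq_add_neg, AddChar.map_add_eq_mul, AddChar.map_neg_eq_conj, mul_comm]
  rw [h1, div_mul_eq_mul_div, sum_mul]
  simp only [sum_mul]
  simp only [← fourierSum_shift]
  unfold fourierSum diffMean
  simp only [div_mul_eq_mul_div, sum_mul]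
  rw [← sum_div]
  congr 1
  rw [sum_comm]
  refine sum_congr rfl fun y _ => ?_
  rw [sum_comm]
  simp only [add_sub_assoc]

/-- A function that is almost invariant under `T - T` varies little in directions in which the
large spectrum of `T` is almost trivial. -/
theorem norm_sub_le_of_almost_periodic {T : Finset G} (hT : T.Nonempty) (F : G → ℂ) {e : ℝ}
    (hF : ∀ v, ∀ y ∈ T, ∀ y' ∈ T, ‖F (v + y - y') - F v‖ ≤ e) (l : ℕ) (t : G) :
    ‖F t - F 0‖ ≤ 2 * l * e + (∑ γ : AddChar G ℂ,
      ‖fourierSum F γ‖ * ‖charMean T γ‖ ^ (2 * l) * ‖1 - γ t‖) / Fintype.card G := by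
  set K := diffMean T with hK
  -- Averaging is a contraction in the supremum norm, so each further step moves the function no
  -- more than the first.
  have hstep : ∀ j v, ‖K^[j + 1] F v - K^[j] F v‖ ≤ e := by
    intro j
    induction j with
    | zero =>
      intro v
      have := norm_diffMean_sub_le hT (f := F) (g := fun _ => F v) v (fun y hy y' hy' => hF v y hy y' hy')
      rwa [diffMean_const hT] at this
    | succ j ih =>
      intro v
      rw [Function.iterate_succ_apply', Function.iterate_succ_apply' K j]
      rw [Function.iterate_succ_apply'] at ih
      exact norm_diffMean_sub_le hT v fun y _ y' _ => ih _
  have hiter : ∀ j v, ‖K^[j] F v - F v‖ ≤ j * e := by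
    intro j v
    induction j with
    | zero => simp
    | succ j ih =>
      have : K^[j + 1] F v - F v = (K^[j + 1] F v - K^[j] F v) + (K^[j] F v - F v) := by ring
      rw [this]
      refine (norm_add_le _ _).trans ?_
      push_cast
      linarith [hstep j v]
  have hfour : ∀ (j : ℕ) γ, fourierSum (K^[j] F) γ =
      ((‖charMean T γ‖ ^ (2 * j) : ℝ) : ℂ) * fourierSum F γ := by
    intro j γ
    induction j with
    | zero => simp
    | succ j ih =>
      rw [Function.iterate_succ_apply', hK, fourierSum_diffMean, ← hK, ih]
      push_cast; ring
  have hN : (0 : ℝ) < Fintype.card G := Nat.cast_pos.2 Fintype.card_pos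
  have hmid : ‖K^[l] F t - K^[l] F 0‖ ≤ (∑ γ : AddChar G ℂ,
      ‖fourierSum F γ‖ * ‖charMean T γ‖ ^ (2 * l) * ‖1 - γ t‖) / Fintype.card G := by
    rw [le_div_iff₀ hN]
    have : ‖K^[l] F t - K^[l] F 0‖ * Fintype.card G =
        ‖Fintype.card G * K^[l] F t - Fintype.card G * K^[l] F 0‖ := by
      rw [← mul_sub, norm_mul, RCLike.norm_natCast, mul_comm]
    rw [this, ← fourierSum_inversion, ← fourierSum_inversion, ← sum_sub_distrib]
    refine norm_sum_le_of_le _ fun γ _ => le_of_eq ?_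
    rw [← mul_sub, hfour, norm_mul, norm_mul, neg_zero, AddChar.map_zero_eq_one, norm_sub_rev,
      AddChar.norm_one_sub_neg, Complex.norm_real, Real.norm_of_nonneg (by positivity)]
    ring
  have : F t - F 0 = -(K^[l] F t - F t) + (K^[l] F t - K^[l] F 0) + (K^[l] F 0 - F 0) := by ring
  rw [this]
  refine (norm_add₃_le).trans ?_
  rw [norm_neg]
  linarith [hiter l t, hiter l 0]

end

/-! ### Almost-periodicity by random sampling -/

/-- Moment bound for a sum of independent centred bounded variables sampled from `S`. -/
theorem sum_piFinset_pow_le {ι : Type*} (S : Finset ι) (X : ι → ℝ)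
    (hX : ∀ z ∈ S, |X z| ≤ 1) (hS : ∑ z ∈ S, X z = 0) {n p : ℕ} (hn : 0 < n) (hp : 0 < p) :
    ∑ z ∈ Fintype.piFinset (fun _ : Fin n => S), (∑ i, X (z i)) ^ (2 * p) ≤
      (#S : ℝ) ^ n * (6 * p * n) ^ p := by
  classical
  have mgf : ∀ s : ℝ, ∑ z ∈ Fintype.piFinset (fun _ : Fin n => S), Real.exp (s * ∑ i, X (z i)) ≤
      (#S : ℝ) ^ n * Real.exp (n * (s ^ 2 / 2)) := by
    intro s
    have h1 : ∑ z ∈ S, Real.exp (s * X z) ≤ #S * Real.exp (s ^ 2 / 2) := by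
      calc ∑ z ∈ S, Real.exp (s * X z) ≤ ∑ z ∈ S, (Real.cosh s + X z * Real.sinh s) :=
            sum_le_sum fun z hz => by
              rw [mul_comm]; exact Real.exp_mul_le_cosh_add_mul_sinh (hX z hz) s
        _ = #S * Real.cosh s := by
            rw [sum_add_distrib, ← sum_mul, hS]; simp
        _ ≤ _ := by gcongr; exact Real.cosh_le_exp_half_sq s
    have h2 : ∑ z ∈ Fintype.piFinset (fun _ : Fin n => S), Real.exp (s * ∑ i, X (z i)) =
        (∑ z ∈ S, Real.exp (s * X z)) ^ n := by
      have := Finset.prod_univ_sum (fun _ : Fin n => S) (fun _ z => Real.exp (s * X z))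
      rw [prod_const, card_univ, Fintype.card_fin] at this
      rw [this]
      exact sum_congr rfl fun z _ => by rw [mul_sum, Real.exp_sum]
    rw [h2, Real.exp_nat_mul, ← mul_pow]
    exact pow_le_pow_left₀ (sum_nonneg fun _ _ => (Real.exp_pos _).le) h1 n
  have hp0 : (0 : ℝ) < p := Nat.cast_pos.2 hp
  have hn0 : (0 : ℝ) < n := Nat.cast_pos.2 hn
  -- With this `s` the moment generating function is bounded by exp(p) ≤ 3^p per sample point. The
  -- moment is then read off from the single term of degree 2p in the series of cosh.
  set s : ℝ := Real.sqrt (2 * p / n) with hs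
  have hs2 : s ^ 2 = 2 * p / n := Real.sq_sqrt (by positivity)
  have pt : ∀ y : ℝ, s ^ (2 * p) * y ^ (2 * p) ≤
      (2 * p).factorial / 2 * (Real.exp (s * y) + Real.exp (-s * y)) := by
    intro y
    have h1 : (s * y) ^ (2 * p) / (2 * p).factorial ≤ Real.cosh (s * y) :=
      le_hasSum (Real.hasSum_cosh (s * y)) p fun j _ =>
        div_nonneg ((even_two_mul j).pow_nonneg _) (Nat.cast_nonneg _)
    rw [div_le_iff₀ (by positivity), Real.cosh_eq, mul_pow] at h1
    rw [neg_mul]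
    linarith
  have hexp : Real.exp (n * (s ^ 2 / 2)) ≤ 3 ^ p := by
    have : (n : ℝ) * (s ^ 2 / 2) = p * 1 := by rw [hs2]; field_simp
    rw [this, Real.exp_nat_mul]
    gcongr
    linarith [Real.exp_one_lt_d9]
  have main : s ^ (2 * p) * ∑ z ∈ Fintype.piFinset (fun _ : Fin n => S),
      (∑ i, X (z i)) ^ (2 * p) ≤ (2 * p).factorial * ((#S : ℝ) ^ n * 3 ^ p) := by
    rw [mul_sum]
    refine (sum_le_sum fun z _ => pt _).trans ?_
    rw [← mul_sum, sum_add_distrib]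
    have h1 := mgf s
    have h2 := mgf (-s)
    rw [neg_sq] at h2
    have h3 : (#S : ℝ) ^ n * Real.exp (n * (s ^ 2 / 2)) ≤ (#S : ℝ) ^ n * 3 ^ p := by gcongr
    have h4 : (0 : ℝ) ≤ (2 * p).factorial := Nat.cast_nonneg _
    nlinarith
  have hfac : ((2 * p).factorial : ℝ) ≤ (2 * p) ^ (2 * p) := by
    exact_mod_cast Nat.factorial_le_pow (2 * p)
  have hspos : 0 < s ^ (2 * p) := by rw [pow_mul, hs2]; positivity
  refine le_of_mul_le_mul_left (main.trans ?_) hspos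
  calc ((2 * p).factorial : ℝ) * ((#S : ℝ) ^ n * 3 ^ p)
      ≤ (2 * p) ^ (2 * p) * ((#S : ℝ) ^ n * 3 ^ p) := by gcongr
    _ = s ^ (2 * p) * ((#S : ℝ) ^ n * (6 * p * n) ^ p) := by
      rw [pow_mul s, hs2, pow_mul, mul_left_comm, mul_left_comm _ ((#S : ℝ) ^ n), ← mul_pow,
        ← mul_pow]
      congr 2
      field_simp; ring

/-- The sum over `x ∈ A` of the values `(f ∗ μ_S) (x + v)`. -/
noncomputable def shiftCorr {G : Type*} [AddCommGroup G] (f : G → ℝ) (A S : Finset G) (v : G) : ℝ :=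
  ∑ x ∈ A, (∑ z ∈ S, f (x + v - z)) / #S

/-- If `f * μ_S` is approximated in `L^{2p}` by the mean of `n` translates of `f`, then so are its
correlations with `A`. -/
theorem abs_sum_mean_sub_shiftCorr_le {G : Type*} [AddCommGroup G] {f : G → ℝ}
    {A S R : Finset G} (hR : ∀ x ∉ R, ∀ z ∈ S, f (x - z) = 0) {n p : ℕ} (hn : 0 < n) (hp : 0 < p)
    {E M : ℝ} (hE0 : 0 ≤ E) (hE : (#A : ℝ) ^ (2 * p - 1) * (M / n ^ (2 * p)) ≤ E ^ (2 * p))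
    {z : Fin n → G} (hz : ∀ i, z i ∈ S)
    (hM : ∑ x ∈ R, (∑ i, (f (x - z i) - (∑ w ∈ S, f (x - w)) / #S)) ^ (2 * p) ≤ M) (v : G) :
    |(∑ x ∈ A, (∑ i, f (x + v - z i)) / n) - shiftCorr f A S v| ≤ E := by
  classical
  have hn0 : (0 : ℝ) < n := Nat.cast_pos.2 hn
  set D : G → ℝ := fun x => ∑ i, (f (x - z i) - (∑ w ∈ S, f (x - w)) / #S) with hD
  have hD0 : ∀ x ∉ R, D x = 0 := fun x hx => by
    simp only [hD]
    refine sum_eq_zero fun i _ => ?_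
    rw [hR x hx _ (hz i), sum_eq_zero fun w hw => hR x hx w hw]; simp
  have h1 : (∑ x ∈ A, (∑ i, f (x + v - z i)) / n) - shiftCorr f A S v =
      ∑ x ∈ A, D (x + v) / n := by
    rw [shiftCorr, ← sum_sub_distrib]
    refine sum_congr rfl fun x _ => ?_
    simp only [hD, sum_sub_distrib, sum_const, card_univ, Fintype.card_fin, nsmul_eq_mul]
    field_simp
  rw [h1]
  have h2p : 2 * p - 1 + 1 = 2 * p := by omega
  -- Since `D` vanishes off `R`, the sum over any translate of `A` is dominated by the sum over `R`.
  -- One good sample therefore works for every `v` at once.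
  have h2 : ∑ x ∈ A, |D (x + v)| ^ (2 * p) ≤ M := by
    refine le_trans ?_ hM
    calc ∑ x ∈ A, |D (x + v)| ^ (2 * p) = ∑ x ∈ A.map (addRightEmbedding v), D x ^ (2 * p) := by
          rw [sum_map]
          exact sum_congr rfl fun x _ => by
            rw [(even_two_mul p).pow_abs]; rfl
      _ = ∑ x ∈ A.map (addRightEmbedding v) with x ∈ R, D x ^ (2 * p) := by
          rw [sum_filter]
          refine sum_congr rfl fun x _ => ?_
          split_ifs with h
          · rfl
          · rw [hD0 x h, zero_pow (by omega)]
      _ ≤ ∑ x ∈ R, D x ^ (2 * p) :=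
          sum_le_sum_of_subset_of_nonneg (fun x hx => (mem_filter.1 hx).2)
            fun x _ _ => (even_two_mul p).pow_nonneg _
  have h3 : |∑ x ∈ A, D (x + v) / n| ^ (2 * p) ≤ E ^ (2 * p) := by
    refine le_trans ?_ hE
    calc |∑ x ∈ A, D (x + v) / n| ^ (2 * p) ≤ (∑ x ∈ A, |D (x + v)| / n) ^ (2 * p) := by
          refine pow_le_pow_left₀ (abs_nonneg _) ((abs_sum_le_sum_abs _ _).trans (le_of_eq ?_)) _
          exact sum_congr rfl fun x _ => by rw [abs_div, Nat.abs_cast]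
      _ ≤ (#A : ℝ) ^ (2 * p - 1) * ∑ x ∈ A, (|D (x + v)| / n) ^ (2 * p) := by
          have := pow_sum_le_card_mul_sum_pow (s := A) (f := fun x => |D (x + v)| / (n : ℝ))
            (fun x _ => by positivity) (2 * p - 1)
          rwa [h2p] at this
      _ = (#A : ℝ) ^ (2 * p - 1) * ((∑ x ∈ A, |D (x + v)| ^ (2 * p)) / n ^ (2 * p)) := by
          rw [sum_div]; simp only [div_pow]
      _ ≤ _ := by gcongr
  exact le_of_pow_le_pow_left₀ (by omega) hE0 h3

/-- Almost-periodicity by random sampling. -/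
theorem exists_almost_periods {G : Type*} [AddCommGroup G] {f : G → ℝ}
    (hf0 : ∀ x, 0 ≤ f x) (hf1 : ∀ x, f x ≤ 1) {A S Y Q R : Finset G} (hS : S.Nonempty)
    (hY : Y.Nonempty) (hR : ∀ x ∉ R, ∀ z ∈ S, f (x - z) = 0) (hQ : ∀ z ∈ S, ∀ y ∈ Y, z + y ∈ Q)
    {n p : ℕ} (hn : 0 < n) (hp : 0 < p) {E : ℝ} (hE0 : 0 ≤ E)
    (hE : (#A : ℝ) ^ (2 * p - 1) * (2 * #R * (6 * p / n) ^ p) ≤ E ^ (2 * p)) :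
    ∃ T ⊆ Y, T.Nonempty ∧ (#S : ℝ) ^ n * #Y ≤ 2 * #Q ^ n * #T ∧
      ∀ v, ∀ y ∈ T, ∀ y' ∈ T, |shiftCorr f A S (v + y - y') - shiftCorr f A S v| ≤ 2 * E := by
  classical
  have hn0 : (0 : ℝ) < n := Nat.cast_pos.2 hn
  have hS0 : (0 : ℝ) < #S := Nat.cast_pos.2 hS.card_pos
  set X : G → G → ℝ := fun x z => f (x - z) - (∑ w ∈ S, f (x - w)) / #S with hXdef
  set M : ℝ := 2 * #R * (6 * p * n) ^ p with hM
  set P := Fintype.piFinset (fun _ : Fin n => S) with hP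
  have hPcard : (#P : ℝ) = (#S : ℝ) ^ n := by simp [hP]
  set good := P.filter fun z => ∑ x ∈ R, (∑ i, X x (z i)) ^ (2 * p) ≤ M with hgood
  have hX1 : ∀ x, ∀ z ∈ S, |X x z| ≤ 1 := fun x z _ => by
    have h1 : (∑ w ∈ S, f (x - w)) / #S ≤ 1 := by
      rw [div_le_one hS0]
      calc ∑ w ∈ S, f (x - w) ≤ ∑ w ∈ S, 1 := sum_le_sum fun w _ => hf1 _
        _ = #S := by simp
    have h2 : 0 ≤ (∑ w ∈ S, f (x - w)) / #S :=
      div_nonneg (sum_nonneg fun w _ => hf0 _) hS0.le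
    rw [abs_le]
    constructor <;> simp only [hXdef] <;> linarith [hf0 (x - z), hf1 (x - z)]
  have hX0 : ∀ x, ∑ z ∈ S, X x z = 0 := fun x => by
    simp only [hXdef, sum_sub_distrib, sum_const, nsmul_eq_mul]
    field_simp; ring
  have hmean : ∑ z ∈ P, ∑ x ∈ R, (∑ i, X x (z i)) ^ (2 * p) ≤ M / 2 * #P := by
    rw [sum_comm]
    calc ∑ x ∈ R, ∑ z ∈ P, (∑ i, X x (z i)) ^ (2 * p)
        ≤ ∑ x ∈ R, (#S : ℝ) ^ n * (6 * p * n) ^ p :=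
          sum_le_sum fun x _ => sum_piFinset_pow_le S (X x) (hX1 x) (hX0 x) hn hp
      _ = _ := by rw [sum_const, nsmul_eq_mul, hM, hPcard]; ring
  -- Markov's inequality: `M` is twice the mean, so at least half of all samples are good.
  have hgoodcard : (#P : ℝ) ≤ 2 * #good := by
    rcases R.eq_empty_or_nonempty with rfl | hRne
    · have : good = P := by
        rw [hgood]; exact filter_true_of_mem fun z _ => by simp [hM]
      rw [this]; linarith [Nat.cast_nonneg (α := ℝ) #P]
    have hM0 : 0 < M := by
      have h1 : (0 : ℝ) < #R := Nat.cast_pos.2 hRne.card_pos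
      have h2 : (0 : ℝ) < p := Nat.cast_pos.2 hp
      positivity
    set bad := P.filter fun z => ¬ ∑ x ∈ R, (∑ i, X x (z i)) ^ (2 * p) ≤ M with hbad
    have h1 : (#good : ℝ) + #bad = #P := by
      exact_mod_cast card_filter_add_card_filter_not (s := P) _
    have h2 : (#bad : ℝ) * M ≤ M / 2 * #P := by
      refine le_trans ?_ hmean
      calc (#bad : ℝ) * M = ∑ z ∈ bad, M := by simp
        _ ≤ ∑ z ∈ bad, ∑ x ∈ R, (∑ i, X x (z i)) ^ (2 * p) :=
          sum_le_sum fun z hz => (not_le.1 (mem_filter.1 hz).2).le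
        _ ≤ _ := sum_le_sum_of_subset_of_nonneg (filter_subset _ _)
          fun z _ _ => sum_nonneg fun x _ => (even_two_mul p).pow_nonneg _
    have h3 : (#bad : ℝ) ≤ #P / 2 := le_of_mul_le_mul_right (by linarith) hM0
    linarith
  -- The pair (z, y) of a good sample and a shift is recorded as w = z + y (diagonally), which lies
  -- in `Q ^ n`. Some w is hit by many y, and these form the set of almost periods.
  set fib : (Fin n → G) → Finset G := fun w => Y.filter fun y => (fun i => w i - y) ∈ good with hfib
  have hQS : (Fintype.piFinset (fun _ : Fin n => Q)).Nonempty := by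
    obtain ⟨z, hz⟩ := hS
    obtain ⟨y, hy⟩ := hY
    exact ⟨fun _ => z + y, Fintype.mem_piFinset.2 fun _ => hQ z hz y hy⟩
  obtain ⟨w, hw, hwmax⟩ := exists_max_image _ (fun w => #(fib w)) hQS
  have hcount : #good * #Y ≤ #Q ^ n * #(fib w) := by
    have h1 : #(good ×ˢ Y) ≤
        #((Fintype.piFinset (fun _ : Fin n => Q)).sigma fib) := by
      refine card_le_card_of_injOn
        (fun a => (⟨fun i => a.1 i + a.2, a.2⟩ : (_ : Fin n → G) × G)) ?_ ?_
      · rintro ⟨z, y⟩ ha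
        rw [mem_coe, mem_product] at ha
        have hzP := Fintype.mem_piFinset.1 (mem_filter.1 ha.1).1
        rw [mem_coe, mem_sigma]
        refine ⟨Fintype.mem_piFinset.2 fun i => hQ _ (hzP i) _ ha.2, mem_filter.2 ⟨ha.2, ?_⟩⟩
        simpa using ha.1
      · rintro ⟨z, y⟩ _ ⟨z', y'⟩ _ h
        simp only [Sigma.mk.injEq, heq_eq_eq] at h
        obtain ⟨h1, rfl⟩ := h
        refine Prod.ext (funext fun i => ?_) rfl
        exact add_right_cancel (congrFun h1 i)
    rw [card_product, card_sigma] at h1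
    refine h1.trans ((sum_le_sum hwmax).trans (le_of_eq ?_))
    rw [sum_const, smul_eq_mul, Fintype.card_piFinset, prod_const, card_univ, Fintype.card_fin]
  have hcount' : (#good : ℝ) * #Y ≤ #Q ^ n * #(fib w) := by exact_mod_cast hcount
  have hY0 : (0 : ℝ) < #Y := Nat.cast_pos.2 hY.card_pos
  have hkey : (#S : ℝ) ^ n * #Y ≤ 2 * #Q ^ n * #(fib w) := by
    rw [← hPcard]
    nlinarith
  refine ⟨fib w, filter_subset _ _, ?_, hkey, ?_⟩
  · rw [nonempty_iff_ne_empty]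
    intro h0
    rw [h0, card_empty, Nat.cast_zero, mul_zero] at hkey
    have : 0 < (#S : ℝ) ^ n * #Y := by positivity
    linarith
  · have hE' : (#A : ℝ) ^ (2 * p - 1) * (M / n ^ (2 * p)) ≤ E ^ (2 * p) := by
      refine le_trans (le_of_eq ?_) hE
      have : M / (n : ℝ) ^ (2 * p) = 2 * #R * (6 * p / n) ^ p := by
        rw [hM, mul_div_assoc, pow_mul, ← div_pow]
        congr 2
        field_simp
      rw [this]
    have hclose : ∀ u, ∀ y ∈ fib w,
        |(∑ x ∈ A, (∑ i, f (x + u - w i)) / n) - shiftCorr f A S (u - y)| ≤ E := by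
      intro u y hy
      have hg := mem_filter.1 (mem_filter.1 hy).2
      have := abs_sum_mean_sub_shiftCorr_le (A := A) hR hn hp hE0 hE'
        (fun i => Fintype.mem_piFinset.1 hg.1 i) hg.2 (u - y)
      have e : ∀ x i, x + (u - y) - (w i - y) = x + u - w i := fun x i => by abel
      simpa only [e] using this
    -- The same translated mean, that of `w` at `v + y`, approximates the correlation both at `v`
    -- (via `y`) and at `v + y - y'` (via `y'`).
    intro v y hy y' hy'
    have h1 := hclose (v + y) y hy
    have h2 := hclose (v + y) y' hy'
    rw [add_sub_cancel_right] at h1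
    rw [abs_le] at h1 h2 ⊢
    constructor <;> linarith

/-! ### A Chang-type theorem relative to a Bohr set -/

/-- `Λ` is dissociated modulo the set of characters `ψ` with `|charMean Z ψ| ≥ 1/2`. -/
def DissociatedMod {G : Type*} [AddCommGroup G] (Z : Finset G) (Λ : Finset (AddChar G ℂ)) : Prop :=
  ∀ e : AddChar G ℂ → ℤ, (∀ γ ∈ Λ, e γ ∈ ({-1, 0, 1} : Finset ℤ)) →
    1 / 2 ≤ ‖charMean Z (∏ γ ∈ Λ, γ ^ e γ)‖ → ∀ γ ∈ Λ, e γ = 0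

section
variable {G : Type*} [AddCommGroup G]

/-- The mean of a character over `Q + Z + ⋯ + Z` with `M` copies of `Z`. -/
theorem sum_sum_piFinset_char (Q Z : Finset G) (M : ℕ) (ψ : AddChar G ℂ) :
    ∑ q ∈ Q, ∑ z ∈ Fintype.piFinset (fun _ : Fin M => Z), ψ (q + ∑ i, z i) =
      (#Q : ℂ) * (#Z : ℂ) ^ M * (charMean Q ψ * charMean Z ψ ^ M) := by
  classical
  have hmul : ∀ T : Finset G, ∑ y ∈ T, ψ y = #T * charMean T ψ := by
    intro T
    rcases T.eq_empty_or_nonempty with rfl | h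
    · simp
    · have : (#T : ℂ) ≠ 0 := by simpa using h.ne_empty
      rw [charMean]; field_simp
  have h1 : ∑ z ∈ Fintype.piFinset (fun _ : Fin M => Z), ψ (∑ i, z i) = (∑ z ∈ Z, ψ z) ^ M := by
    have := Finset.prod_univ_sum (fun _ : Fin M => Z) (fun _ z => ψ z)
    rw [prod_const, card_univ, Fintype.card_fin] at this
    rw [this]
    exact sum_congr rfl fun z _ => map_prod ψ.toMonoidHom (fun i => Multiplicative.ofAdd (z i)) univ
  simp only [AddChar.map_add_eq_mul]
  simp only [← mul_sum, h1, ← sum_mul]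
  rw [hmul, hmul]; ring

/-- A non-negative function has larger average over `Y` than over `Q + Z + ⋯ + Z`, up to the ratio
of sizes, if `Y - Z - ⋯ - Z ⊆ Q`. -/
theorem sum_le_sum_sum_piFinset {Q Y Z : Finset G} {M : ℕ}
    (hQ : ∀ y ∈ Y, ∀ z : Fin M → G, (∀ i, z i ∈ Z) → y - ∑ i, z i ∈ Q) {Φ : G → ℝ}
    (hΦ : ∀ x, 0 ≤ Φ x) :
    (#Z : ℝ) ^ M * ∑ y ∈ Y, Φ y ≤
      ∑ q ∈ Q, ∑ z ∈ Fintype.piFinset (fun _ : Fin M => Z), Φ (q + ∑ i, z i) := by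
  classical
  rw [sum_comm]
  have : (#Z : ℝ) ^ M * ∑ y ∈ Y, Φ y =
      ∑ z ∈ Fintype.piFinset (fun _ : Fin M => Z), ∑ y ∈ Y, Φ y := by simp
  rw [this]
  refine sum_le_sum fun z hz => ?_
  rw [Fintype.mem_piFinset] at hz
  calc ∑ y ∈ Y, Φ y = ∑ q ∈ Y.map (Equiv.subRight (∑ i, z i)).toEmbedding, Φ (q + ∑ i, z i) := by
        rw [sum_map]; exact sum_congr rfl fun y _ => by simp
    _ ≤ _ := by
        refine sum_le_sum_of_subset_of_nonneg ?_ fun _ _ _ => hΦ _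
        intro q hq
        obtain ⟨y, hy, rfl⟩ := mem_map.1 hq
        exact hQ y hy z hz

/-- The Riesz product of a dissociated set has integral at most two. -/
theorem norm_sum_rieszProduct_le [Finite G] {Q Z : Finset G} {Λ : Finset (AddChar G ℂ)}
    (hΛ : DissociatedMod Z Λ) (ω : AddChar G ℂ → ℂ) (hω : ∀ γ, ‖ω γ‖ ≤ 1) :
    ‖∑ q ∈ Q, ∑ z ∈ Fintype.piFinset (fun _ : Fin #Λ => Z),
      ∏ γ ∈ Λ, (1 + ((ω γ * γ (q + ∑ i, z i)).re : ℂ))‖ ≤ 2 * (#Q * (#Z : ℝ) ^ #Λ) := by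
  classical
  have : Fintype G := Fintype.ofFinite G
  set U : Finset ℤ := {-1, 0, 1} with hU
  let c : AddChar G ℂ → ℤ → ℂ := fun γ e =>
    if e = 0 then 1 else if e = 1 then ω γ / 2 else (starRingEnd ℂ) (ω γ) / 2
  have hfac : ∀ (γ : AddChar G ℂ) (x : G),
      1 + ((ω γ * γ x).re : ℂ) = ∑ e ∈ U, c γ e * (γ ^ e) x := by
    intro γ x
    have hre : ((ω γ * γ x).re : ℂ) = (ω γ * γ x + (starRingEnd ℂ) (ω γ) * γ (-x)) / 2 := by
      rw [AddChar.map_neg_eq_conj, ← map_mul, Complex.add_conj]; push_cast; ring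
    have : ∑ e ∈ U, c γ e * (γ ^ e) x = (starRingEnd ℂ) (ω γ) / 2 * γ (-x) + (1 + ω γ / 2 * γ x) := by
      rw [hU, sum_insert (by decide), sum_insert (by decide), sum_singleton]
      simp [c]
    rw [hre, this]; ring
  have hprod : ∀ x : G, ∏ γ ∈ Λ, (1 + ((ω γ * γ x).re : ℂ)) =
      ∑ e ∈ Λ.pi (fun _ => U), (∏ γ ∈ Λ.attach, c γ (e γ γ.2)) *
        (∏ γ ∈ Λ.attach, (γ : AddChar G ℂ) ^ e γ γ.2) x := by
    intro x
    simp only [hfac]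
    rw [prod_sum]
    refine sum_congr rfl fun e _ => ?_
    rw [AddChar.prod_apply, ← prod_mul_distrib]
  simp only [hprod]
  have hswap : ∑ q ∈ Q, ∑ z ∈ Fintype.piFinset (fun _ : Fin #Λ => Z),
      ∑ e ∈ Λ.pi (fun _ => U), (∏ γ ∈ Λ.attach, c γ (e γ γ.2)) *
        (∏ γ ∈ Λ.attach, (γ : AddChar G ℂ) ^ e γ γ.2) (q + ∑ i, z i) =
      ∑ e ∈ Λ.pi (fun _ => U), (∏ γ ∈ Λ.attach, c γ (e γ γ.2)) *
        ((#Q : ℂ) * (#Z : ℂ) ^ #Λ * (charMean Q (∏ γ ∈ Λ.attach, (γ : AddChar G ℂ) ^ e γ γ.2) *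
          charMean Z (∏ γ ∈ Λ.attach, (γ : AddChar G ℂ) ^ e γ γ.2) ^ #Λ)) := by
    simp only [← sum_sum_piFinset_char, mul_sum]
    have : ∀ q ∈ Q, ∑ z ∈ Fintype.piFinset (fun _ : Fin #Λ => Z),
        ∑ e ∈ Λ.pi (fun _ => U), (∏ γ ∈ Λ.attach, c γ (e γ γ.2)) *
          (∏ γ ∈ Λ.attach, (γ : AddChar G ℂ) ^ e γ γ.2) (q + ∑ i, z i) =
        ∑ e ∈ Λ.pi (fun _ => U), ∑ z ∈ Fintype.piFinset (fun _ : Fin #Λ => Z),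
          (∏ γ ∈ Λ.attach, c γ (e γ γ.2)) *
          (∏ γ ∈ Λ.attach, (γ : AddChar G ℂ) ^ e γ γ.2) (q + ∑ i, z i) := fun q _ => sum_comm
    rw [sum_congr rfl this, sum_comm]
  rw [hswap]
  set W : ℝ := #Q * (#Z : ℝ) ^ #Λ with hW
  have hW0 : 0 ≤ W := by positivity
  have hc : ∀ γ, ∑ e ∈ U, ‖c γ e‖ ≤ 2 := by
    intro γ
    have : ∑ e ∈ U, ‖c γ e‖ = ‖ω γ‖ / 2 + (1 + ‖ω γ‖ / 2) := by
      rw [hU, sum_insert (by decide), sum_insert (by decide), sum_singleton]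
      simp [c]
    rw [this]; linarith [hω γ]
  have hcsum : ∑ e ∈ Λ.pi (fun _ => U), ∏ γ ∈ Λ.attach, ‖c γ (e γ γ.2)‖ ≤ 2 ^ #Λ := by
    rw [← prod_sum Λ (fun _ => U) (fun γ e => ‖c γ e‖), ← prod_const]
    exact prod_le_prod (fun γ _ => sum_nonneg fun _ _ => norm_nonneg _) fun γ _ => hc γ
  let e₀ : (γ : AddChar G ℂ) → γ ∈ Λ → ℤ := fun _ _ => 0
  -- The zero exponent gives the main term `W`. For any other, dissociativity makes the transform of
  -- `Z` at most 1/2, and the #Λ copies of `Z` turn this into 2^(-#Λ), which offsets the total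
  -- coefficient mass of at most 2^#Λ.
  have hterm : ∀ e ∈ Λ.pi (fun _ => U), ‖(∏ γ ∈ Λ.attach, c γ (e γ γ.2)) *
        ((#Q : ℂ) * (#Z : ℂ) ^ #Λ * (charMean Q (∏ γ ∈ Λ.attach, (γ : AddChar G ℂ) ^ e γ γ.2) *
          charMean Z (∏ γ ∈ Λ.attach, (γ : AddChar G ℂ) ^ e γ γ.2) ^ #Λ))‖ ≤
      (if e = e₀ then W else 0) + W * ((∏ γ ∈ Λ.attach, ‖c γ (e γ γ.2)‖) * (1 / 2) ^ #Λ) := by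
    intro e he
    set ψ : AddChar G ℂ := ∏ γ ∈ Λ.attach, (γ : AddChar G ℂ) ^ e γ γ.2 with hψ
    have hn : ‖(∏ γ ∈ Λ.attach, c γ (e γ γ.2)) *
        ((#Q : ℂ) * (#Z : ℂ) ^ #Λ * (charMean Q ψ * charMean Z ψ ^ #Λ))‖ =
        W * ((∏ γ ∈ Λ.attach, ‖c γ (e γ γ.2)‖) * (‖charMean Q ψ‖ * ‖charMean Z ψ‖ ^ #Λ)) := by
      simp only [norm_mul, norm_pow, norm_prod, RCLike.norm_natCast]
      rw [hW]; ring
    rw [hn]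
    have hP : 0 ≤ ∏ γ ∈ Λ.attach, ‖c γ (e γ γ.2)‖ := prod_nonneg fun _ _ => norm_nonneg _
    have hQ1 := norm_charMean_le_one Q ψ
    split_ifs with h0
    · subst h0
      have : ∏ γ ∈ Λ.attach, ‖c γ (e₀ γ γ.2)‖ = 1 := prod_eq_one fun γ _ => by simp [c, e₀]
      rw [this, one_mul, one_mul]
      have h1 : ‖charMean Q ψ‖ * ‖charMean Z ψ‖ ^ #Λ ≤ 1 :=
        mul_le_one₀ hQ1 (by positivity) (pow_le_one₀ (norm_nonneg _) (norm_charMean_le_one Z ψ))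
      have h2 : 0 ≤ W * (1 / 2 : ℝ) ^ #Λ := by positivity
      nlinarith
    · rw [zero_add]
      have hZ1 : ‖charMean Z ψ‖ ≤ 1 / 2 := by
        by_contra! hlt
        refine h0 ?_
        have h1 := hΛ (fun γ => if h : γ ∈ Λ then e γ h else 0) (fun γ hγ => by
          simp only [hγ, dif_pos]; exact mem_pi.1 he γ hγ) (by
          rw [← prod_attach]
          simp only [coe_mem, dif_pos]
          exact hlt.le)
        funext γ hγ
        have := h1 γ hγ
        simpa only [hγ, dif_pos] using this
      refine mul_le_mul_of_nonneg_left (mul_le_mul_of_nonneg_left ?_ hP) hW0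
      calc ‖charMean Q ψ‖ * ‖charMean Z ψ‖ ^ #Λ ≤ 1 * (1 / 2) ^ #Λ := by gcongr
        _ = _ := one_mul _
  refine (norm_sum_le_of_le _ hterm).trans ?_
  rw [sum_add_distrib, ← mul_sum, ← sum_mul]
  have h1 : ∑ e ∈ Λ.pi (fun _ => U), (if e = e₀ then W else 0) ≤ W := by
    rw [sum_ite_eq']
    split_ifs
    · exact le_rfl
    · exact hW0
  have h2 : (∑ e ∈ Λ.pi (fun _ => U), ∏ γ ∈ Λ.attach, ‖c γ (e γ γ.2)‖) * (1 / 2 : ℝ) ^ #Λ ≤ 1 := by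
    calc _ ≤ (2 : ℝ) ^ #Λ * (1 / 2) ^ #Λ := by gcongr
      _ = 1 := by rw [← mul_pow]; norm_num
  nlinarith [mul_le_mul_of_nonneg_left h2 hW0]

/-- A Chang-type bound for the size of dissociated sets in the large spectrum of `T`. -/
theorem card_le_of_dissociatedMod [Finite G] {T Y Z Q : Finset G} {Λ : Finset (AddChar G ℂ)}
    (hTY : T ⊆ Y) (hT : T.Nonempty) (hZ : Z.Nonempty)
    (hQ : ∀ y ∈ Y, ∀ z : Fin #Λ → G, (∀ i, z i ∈ Z) → y - ∑ i, z i ∈ Q)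
    (hQY : (#Q : ℝ) ≤ 2 * #Y) (hΛ : DissociatedMod Z Λ)
    (hspec : ∀ γ ∈ Λ, 1 / 2 ≤ ‖charMean T γ‖) :
    (#Λ : ℝ) ≤ 8 * Real.log (4 * #Y / #T) := by
  classical
  have : Fintype G := Fintype.ofFinite G
  have hT0 : (0 : ℝ) < #T := Nat.cast_pos.2 hT.card_pos
  have hY0 : (0 : ℝ) < #Y := Nat.cast_pos.2 (hT.mono hTY).card_pos
  have hZ0 : (0 : ℝ) < #Z := Nat.cast_pos.2 hZ.card_pos
  let ω : AddChar G ℂ → ℂ := fun γ => (starRingEnd ℂ) (charMean T γ) / ‖charMean T γ‖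
  have hω : ∀ γ, ‖ω γ‖ ≤ 1 := fun γ => by
    simp only [ω, norm_div, RCLike.norm_conj, Complex.norm_real, norm_norm]
    exact div_self_le_one _
  -- Convexity of exp on [-1, 1] gives exp(u/2) ≤ cosh(1/2)(1 + th · u), where cosh(1/2) ≤ exp(1/8).
  -- This turns the exponential into a Riesz product.
  set th : ℝ := Real.sinh (1 / 2) / Real.cosh (1 / 2) with hth
  have hch : 0 < Real.cosh (1 / 2) := Real.cosh_pos _
  have hth0 : 0 ≤ th := div_nonneg (Real.sinh_nonneg_iff.2 (by norm_num)) hch.le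
  have hth1 : th ≤ 1 := by
    rw [hth, div_le_one hch]; exact (Real.sinh_lt_cosh _).le
  let u : AddChar G ℂ → G → ℝ := fun γ x => (ω γ * γ x).re
  have hu : ∀ γ x, |u γ x| ≤ 1 := fun γ x => by
    refine (Complex.abs_re_le_norm _).trans ?_
    rw [norm_mul, AddChar.norm_apply, mul_one]
    exact hω γ
  -- The mean of `Φ` over `Y` is at most 4 exp(#Λ/8) by the Riesz product bound. Its mean over `T`
  -- is at least exp(#Λ/4), because the phases `ω` align the large coefficients. Comparing the two
  -- bounds #Λ by the density of `T`.
  let Φ : G → ℝ := fun x => Real.exp ((∑ γ ∈ Λ, u γ x) / 2)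
  have hΦ : ∀ x, Φ x ≤ Real.exp (#Λ / 8) * ∏ γ ∈ Λ, (1 + th * u γ x) := by
    intro x
    have h1 : ∀ γ ∈ Λ, Real.exp (u γ x / 2) ≤ Real.exp (1 / 8) * (1 + th * u γ x) := by
      intro γ _
      have h2 := Real.exp_mul_le_cosh_add_mul_sinh (hu γ x) (1 / 2)
      have h3 : Real.cosh (1 / 2) + u γ x * Real.sinh (1 / 2) =
          Real.cosh (1 / 2) * (1 + th * u γ x) := by
        rw [hth]; field_simp
      have h4 : Real.cosh (1 / 2) ≤ Real.exp (1 / 8) := by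
        refine (Real.cosh_le_exp_half_sq _).trans (le_of_eq ?_)
        norm_num
      have h5 : 0 ≤ 1 + th * u γ x := by
        have := (abs_le.1 (hu γ x)).1
        nlinarith
      calc Real.exp (u γ x / 2) = Real.exp (u γ x * (1 / 2)) := by ring_nf
        _ ≤ _ := h2
        _ = _ := h3
        _ ≤ _ := by gcongr
    calc Φ x = ∏ γ ∈ Λ, Real.exp (u γ x / 2) := by
          simp only [Φ]; rw [sum_div, Real.exp_sum]
      _ ≤ ∏ γ ∈ Λ, (Real.exp (1 / 8) * (1 + th * u γ x)) :=
          prod_le_prod (fun _ _ => (Real.exp_pos _).le) h1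
      _ = _ := by
          rw [prod_mul_distrib, prod_const, ← Real.exp_nat_mul]
          congr 2; ring
  have hR := norm_sum_rieszProduct_le (Q := Q) hΛ (fun γ => th * ω γ) (fun γ => by
    rw [norm_mul, Complex.norm_real, Real.norm_of_nonneg hth0]
    exact mul_le_one₀ hth1 (norm_nonneg _) (hω γ))
  have hRe : ∑ q ∈ Q, ∑ z ∈ Fintype.piFinset (fun _ : Fin #Λ => Z),
      ∏ γ ∈ Λ, (1 + th * u γ (q + ∑ i, z i)) ≤ 2 * (#Q * (#Z : ℝ) ^ #Λ) := by
    refine le_trans (le_trans (le_abs_self _) (le_of_eq ?_)) hR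
    rw [← Real.norm_eq_abs, ← Complex.norm_real]
    congr 1
    push_cast
    refine sum_congr rfl fun q _ => sum_congr rfl fun z _ => prod_congr rfl fun γ _ => ?_
    congr 1
    rw [mul_assoc, Complex.re_ofReal_mul]
    push_cast; rfl
  have hsumY : ∑ y ∈ Y, Φ y ≤ 4 * Real.exp (#Λ / 8) * #Y := by
    have h1 := sum_le_sum_sum_piFinset (Z := Z) hQ (Φ := Φ) fun x => (Real.exp_pos _).le
    have h2 : ∑ q ∈ Q, ∑ z ∈ Fintype.piFinset (fun _ : Fin #Λ => Z), Φ (q + ∑ i, z i) ≤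
        Real.exp (#Λ / 8) * (2 * (#Q * (#Z : ℝ) ^ #Λ)) := by
      refine le_trans (sum_le_sum fun q _ => sum_le_sum fun z _ => hΦ _) ?_
      simp only [← mul_sum]
      gcongr
    have hZM : 0 < (#Z : ℝ) ^ #Λ := by positivity
    refine le_of_mul_le_mul_left (h1.trans (h2.trans ?_)) hZM
    calc Real.exp (#Λ / 8) * (2 * (#Q * (#Z : ℝ) ^ #Λ))
        ≤ Real.exp (#Λ / 8) * (2 * (2 * #Y * (#Z : ℝ) ^ #Λ)) := by gcongr
      _ = _ := by ring
  have hmean : (#Λ : ℝ) / 2 * #T ≤ ∑ y ∈ T, ∑ γ ∈ Λ, u γ y := by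
    rw [sum_comm]
    calc (#Λ : ℝ) / 2 * #T = ∑ γ ∈ Λ, 1 / 2 * (#T : ℝ) := by
          rw [sum_const, nsmul_eq_mul]; ring
      _ ≤ _ := by
          refine sum_le_sum fun γ hγ => ?_
          have h1 : ∑ y ∈ T, u γ y = ‖charMean T γ‖ * #T := by
            have hne : (‖charMean T γ‖ : ℂ) ≠ 0 := by
              have := hspec γ hγ
              exact_mod_cast (by linarith : (0 : ℝ) < ‖charMean T γ‖).ne'
            have hTc : (#T : ℂ) ≠ 0 := by exact_mod_cast hT0.ne'
            have h3 : ∑ y ∈ T, ω γ * γ y = ((‖charMean T γ‖ * #T : ℝ) : ℂ) := by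
              rw [← mul_sum]
              have h4 : ∑ y ∈ T, γ y = charMean T γ * #T := by rw [charMean]; field_simp
              rw [h4]
              simp only [ω]
              have h5 : (starRingEnd ℂ) (charMean T γ) * charMean T γ =
                  (‖charMean T γ‖ : ℂ) ^ 2 := by
                rw [mul_comm, Complex.mul_conj, Complex.normSq_eq_norm_sq]; push_cast; rfl
              rw [div_mul_eq_mul_div, ← mul_assoc, h5]
              push_cast; field_simp
            simp only [u]
            rw [← Complex.re_sum, h3, Complex.ofReal_re]
          rw [h1]
          exact mul_le_mul_of_nonneg_right (hspec γ hγ) hT0.le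
  have hjensen : Real.exp (#Λ / 4) * #T ≤ ∑ y ∈ T, Φ y := by
    -- Jensen's inequality through the tangent line of exp at #Λ/4.
    have h1 : ∀ y ∈ T, Real.exp (#Λ / 4) * (1 + ((∑ γ ∈ Λ, u γ y) / 2 - #Λ / 4)) ≤ Φ y := by
      intro y _
      have h2 : Φ y = Real.exp (#Λ / 4) * Real.exp ((∑ γ ∈ Λ, u γ y) / 2 - #Λ / 4) := by
        rw [← Real.exp_add, add_sub_cancel]
      rw [h2]
      gcongr
      linarith [Real.add_one_le_exp ((∑ γ ∈ Λ, u γ y) / 2 - #Λ / 4)]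
    refine le_trans ?_ (sum_le_sum h1)
    rw [← mul_sum]
    gcongr
    rw [sum_add_distrib, sum_sub_distrib, ← sum_div]
    simp only [sum_const, nsmul_eq_mul]
    linarith
  have hsub : ∑ y ∈ T, Φ y ≤ ∑ y ∈ Y, Φ y :=
    sum_le_sum_of_subset_of_nonneg hTY fun _ _ _ => (Real.exp_pos _).le
  have hfin : Real.exp (#Λ / 8) ≤ 4 * #Y / #T := by
    rw [le_div_iff₀ hT0]
    have h1 : Real.exp (#Λ / 4) = Real.exp (#Λ / 8) * Real.exp (#Λ / 8) := by
      rw [← Real.exp_add]; congr 1; ring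
    have h2 := hjensen.trans (hsub.trans hsumY)
    rw [h1] at h2
    refine le_of_mul_le_mul_left ?_ (Real.exp_pos (#Λ / 8))
    linarith
  have := (Real.le_log_iff_exp_le (by positivity)).2 hfin
  linarith

theorem DissociatedMod.subset {Z : Finset G} {Λ Λ' : Finset (AddChar G ℂ)}
    (h : DissociatedMod Z Λ) (hs : Λ' ⊆ Λ) : DissociatedMod Z Λ' := by
  classical
  intro e he hm γ hγ
  have h1 := h (fun γ => if γ ∈ Λ' then e γ else 0) (fun γ _ => by
    split_ifs with hm'
    · exact he γ hm'
    · simp) (by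
    have : ∏ γ ∈ Λ, γ ^ (if γ ∈ Λ' then e γ else 0) = ∏ γ ∈ Λ', γ ^ e γ := by
      rw [← prod_subset hs fun γ _ hγ' => by rw [if_neg hγ', zpow_zero]]
      exact prod_congr rfl fun γ hγ' => by rw [if_pos hγ']
    rwa [this]) γ (hs hγ)
  simpa [hγ] using h1

theorem AddChar.norm_one_sub_zpow_le [Finite G] (γ : AddChar G ℂ) (x : G) {e : ℤ}
    (he : e ∈ ({-1, 0, 1} : Finset ℤ)) : ‖1 - (γ ^ e) x‖ ≤ ‖1 - γ x‖ := by
  have : Fintype G := Fintype.ofFinite G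
  simp only [mem_insert, mem_singleton] at he
  rcases he with rfl | rfl | rfl
  · rw [zpow_neg_one, AddChar.inv_apply, AddChar.norm_one_sub_neg]
  · simp
  · rw [zpow_one]

theorem AddChar.norm_one_sub_mul_le [Finite G] (γ ψ : AddChar G ℂ) (x : G) :
    ‖1 - (γ * ψ) x‖ ≤ ‖1 - γ x‖ + ‖1 - ψ x‖ := by
  have : 1 - (γ * ψ) x = (1 - γ x) + γ x * (1 - ψ x) := by rw [AddChar.mul_apply]; ring
  rw [this]
  refine (norm_add_le _ _).trans ?_
  rw [norm_mul, AddChar.norm_apply, one_mul]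

theorem AddChar.norm_one_sub_prod_zpow_le [Finite G] (Λ : Finset (AddChar G ℂ))
    (e : AddChar G ℂ → ℤ) (he : ∀ γ ∈ Λ, e γ ∈ ({-1, 0, 1} : Finset ℤ)) (x : G) :
    ‖1 - (∏ γ ∈ Λ, γ ^ e γ) x‖ ≤ ∑ γ ∈ Λ, ‖1 - γ x‖ := by
  classical
  induction Λ using Finset.induction_on with
  | empty => simp
  | insert a s ha ih =>
    rw [prod_insert ha, sum_insert ha]
    refine (AddChar.norm_one_sub_mul_le _ _ _).trans (add_le_add ?_ ?_)
    · exact AddChar.norm_one_sub_zpow_le _ _ (he a (mem_insert_self _ _))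
    · exact ih fun γ hγ => he γ (mem_insert_of_mem hγ)

/-- The large spectrum of `T` is controlled by few characters and the large spectrum of `Z`. -/
theorem exists_spectrum_control [Finite G] {T Y Z Q : Finset G} {M : ℕ}
    (hTY : T ⊆ Y) (hT : T.Nonempty) (hZ : Z.Nonempty)
    (hQ : ∀ y ∈ Y, ∀ z : Fin M → G, (∀ i, z i ∈ Z) → y - ∑ i, z i ∈ Q)
    (hQY : (#Q : ℝ) ≤ 2 * #Y) (hM : 8 * Real.log (4 * #Y / #T) < M) :
    ∃ Λ : Finset (AddChar G ℂ), #Λ < M ∧ ∀ γ : AddChar G ℂ, 1 / 2 ≤ ‖charMean T γ‖ →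
      ∃ ψ : AddChar G ℂ, 1 / 2 ≤ ‖charMean Z ψ‖ ∧
        ∀ x, ‖1 - γ x‖ ≤ ‖1 - ψ x‖ + ∑ l ∈ Λ, ‖1 - l x‖ := by
  classical
  have : Fintype G := Fintype.ofFinite G
  have hone : charMean Z (1 : AddChar G ℂ) = 1 := by
    have : (#Z : ℂ) ≠ 0 := by simpa using hZ.ne_empty
    simp [charMean, this]
  set fam := (univ : Finset (AddChar G ℂ)).powerset.filter
    fun Λ => DissociatedMod Z Λ ∧ ∀ γ ∈ Λ, 1 / 2 ≤ ‖charMean T γ‖ with hfam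
  have hne : fam.Nonempty := ⟨∅, by simp [hfam, DissociatedMod]⟩
  obtain ⟨Λ, hΛ, hmax⟩ := exists_max_image fam card hne
  obtain ⟨-, hdiss, hspec⟩ := mem_filter.1 hΛ
  refine ⟨Λ, ?_, ?_⟩
  -- The hypothesis on `Q` concerns sums of exactly `M` elements, so the size bound is applied to a
  -- subset of exactly `M` characters.
  · by_contra! hle
    obtain ⟨Λ', hs, hc⟩ := exists_subset_card_eq hle
    subst hc
    have := card_le_of_dissociatedMod hTY hT hZ hQ hQY (hdiss.subset hs)
      fun γ hγ => hspec γ (hs hγ)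
    linarith
  · intro γ hγ
    by_cases hmem : γ ∈ Λ
    · refine ⟨1, by rw [hone]; norm_num, fun x => ?_⟩
      have := single_le_sum (f := fun l : AddChar G ℂ => ‖1 - l x‖) (fun _ _ => norm_nonneg _) hmem
      simpa using this
    · have hnot : ¬ DissociatedMod Z (insert γ Λ) := by
        intro hd
        have h1 : insert γ Λ ∈ fam := by
          rw [hfam, mem_filter]
          refine ⟨by simp, hd, fun γ' hγ' => ?_⟩
          rcases mem_insert.1 hγ' with rfl | h
          · exact hγ
          · exact hspec _ h
        have h2 := hmax _ h1
        rw [card_insert_of_notMem hmem] at h2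
        omega
      unfold DissociatedMod at hnot
      push Not at hnot
      obtain ⟨e, he, hbig, γ', hγ', hne'⟩ := hnot
      rw [prod_insert hmem] at hbig
      have heγ := he γ (mem_insert_self _ _)
      have he' : ∀ γ ∈ Λ, e γ ∈ ({-1, 0, 1} : Finset ℤ) := fun γ h => he γ (mem_insert_of_mem h)
      set P := ∏ γ ∈ Λ, γ ^ e γ with hP
      -- Were this exponent zero, the relation would live on `Λ` and contradict its dissociativity.
      -- As the exponent is ±1, the relation can be solved for γ.
      have hγ0 : e γ ≠ 0 := by
        intro h0
        rw [h0, zpow_zero, one_mul] at hbig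
        have h1 := hdiss e he' hbig
        rcases mem_insert.1 hγ' with rfl | h
        · exact hne' h0
        · exact hne' (h1 _ h)
      refine ⟨γ ^ e γ * P, hbig, fun x => ?_⟩
      have hPx : ‖1 - P⁻¹ x‖ ≤ ∑ l ∈ Λ, ‖1 - l x‖ := by
        rw [AddChar.inv_apply, AddChar.norm_one_sub_neg]
        exact AddChar.norm_one_sub_prod_zpow_le Λ e he' x
      have h2 : ‖1 - (γ ^ e γ) x‖ ≤ ‖1 - (γ ^ e γ * P) x‖ + ‖1 - P⁻¹ x‖ := by
        have := AddChar.norm_one_sub_mul_le (γ ^ e γ * P) P⁻¹ x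
        rwa [mul_inv_cancel_right] at this
      have h3 : ‖1 - (γ ^ e γ) x‖ = ‖1 - γ x‖ := by
        simp only [mem_insert, mem_singleton] at heγ
        rcases heγ with h | h | h
        · rw [h, zpow_neg_one, AddChar.inv_apply, AddChar.norm_one_sub_neg]
        · exact absurd h hγ0
        · rw [h, zpow_one]
      rw [h3] at h2
      linarith

end

/-! ### Cutting by characters, and characters with a large mean -/

/-- If `U - U ⊆ V`, then `V` has many elements at which the characters in `Λ` are close to `1`. -/
theorem card_mul_pow_le_card_filter {G : Type*} [AddCommGroup G] [Finite G] {U V : Finset G}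
    (hUV : ∀ x ∈ U, ∀ x' ∈ U, x - x' ∈ V) (Λ : Finset (AddChar G ℂ)) {θ : ℝ} (hθ : 0 < θ)
    (hθ2 : θ ≤ 2) [DecidablePred fun y : G => ∀ l ∈ Λ, ‖1 - l y‖ ≤ θ] :
    (#U : ℝ) * (θ / 8) ^ (2 * #Λ) ≤ #(V.filter fun y => ∀ l ∈ Λ, ‖1 - l y‖ ≤ θ) := by
  classical
  have : Fintype G := Fintype.ofFinite G
  rcases U.eq_empty_or_nonempty with rfl | hU
  · simp
  set I : Finset ℤ := Icc ⌊-(2 / θ)⌋ ⌊2 / θ⌋ with hI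
  have hIcard : (#I : ℝ) ≤ 8 / θ := by
    have h1 : (⌊2 / θ⌋ : ℝ) ≤ 2 / θ := Int.floor_le _
    have h2 : -(2 / θ) < ⌊-(2 / θ)⌋ + 1 := Int.lt_floor_add_one _
    have h3 : (0 : ℝ) ≤ ⌊2 / θ⌋ + 1 - ⌊-(2 / θ)⌋ := by
      have h4 : ⌊-(2 / θ)⌋ ≤ ⌊2 / θ⌋ := Int.floor_le_floor (by
        have : 0 < 2 / θ := by positivity
        linarith)
      have : (⌊-(2 / θ)⌋ : ℝ) ≤ ⌊2 / θ⌋ := by exact_mod_cast h4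
      linarith
    have h5 : (#I : ℝ) = ⌊2 / θ⌋ + 1 - ⌊-(2 / θ)⌋ := by
      rw [hI, Int.card_Icc, ← Int.cast_natCast, Int.toNat_of_nonneg (by exact_mod_cast h3)]
      push_cast; ring
    have h6 : 2 ≤ 4 / θ := by rw [le_div_iff₀ hθ]; linarith
    have h7 : 8 / θ = 2 / θ + 2 / θ + 4 / θ := by ring
    rw [h5, h7]; linarith
  -- Squares of side θ/2: two values in one cell differ by at most θ, and each character needs at
  -- most (8/θ)² cells. Differences with a fixed point of a popular cell then lie in the required
  -- set.
  let cell : G → Λ → ℤ × ℤ := fun x l => (⌊(l.1 x).re / (θ / 2)⌋, ⌊(l.1 x).im / (θ / 2)⌋)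
  set box : Finset (Λ → ℤ × ℤ) := Fintype.piFinset fun _ => I ×ˢ I with hbox
  have hmaps : ∀ x ∈ U, cell x ∈ box := by
    intro x _
    rw [hbox, Fintype.mem_piFinset]
    have key : ∀ r : ℝ, |r| ≤ 1 → ⌊r / (θ / 2)⌋ ∈ I := by
      intro r hr
      have h1 : r / (θ / 2) = r * (2 / θ) := by field_simp
      have h2 : 0 < 2 / θ := by positivity
      rw [abs_le] at hr
      rw [hI, mem_Icc, h1]
      exact ⟨Int.floor_le_floor (by nlinarith), Int.floor_le_floor (by nlinarith)⟩
    intro l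
    rw [mem_product]
    exact ⟨key _ ((Complex.abs_re_le_norm _).trans (AddChar.norm_apply _ _).le),
      key _ ((Complex.abs_im_le_norm _).trans (AddChar.norm_apply _ _).le)⟩
  have hboxne : box.Nonempty := hU.elim fun x hx => ⟨_, hmaps x hx⟩
  have hbox0 : (0 : ℝ) < #box := Nat.cast_pos.2 hboxne.card_pos
  have hboxcard : (#box : ℝ) ≤ (8 / θ) ^ (2 * #Λ) := by
    rw [hbox, Fintype.card_piFinset, prod_const, card_product, card_univ, Fintype.card_coe, ← sq,
      ← pow_mul]
    push_cast
    gcongr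
  obtain ⟨c, -, hc⟩ := exists_le_card_fiber_of_nsmul_le_card_of_maps_to (b := (#U : ℝ) / #box)
    hmaps hboxne (by rw [nsmul_eq_mul, mul_div_cancel₀ _ hbox0.ne'])
  have hU0 : (0 : ℝ) < #U := Nat.cast_pos.2 hU.card_pos
  have hlow : (#U : ℝ) * (θ / 8) ^ (2 * #Λ) ≤ #U / #box := by
    rw [div_eq_mul_inv (#U : ℝ)]
    refine mul_le_mul_of_nonneg_left ?_ hU0.le
    rw [show θ / 8 = (8 / θ)⁻¹ by rw [inv_div], inv_pow]
    exact inv_anti₀ hbox0 hboxcard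
  refine hlow.trans (hc.trans (Nat.cast_le.2 ?_))
  have hfne : (U.filter fun x => cell x = c).Nonempty := by
    rw [← card_pos, ← Nat.cast_pos (α := ℝ)]
    exact lt_of_lt_of_le (by positivity) hc
  obtain ⟨x₀, hx₀⟩ := hfne
  rw [mem_filter] at hx₀
  refine card_le_card_of_injOn (fun x => x - x₀) ?_ fun x _ y _ h => sub_left_injective h
  intro x hx
  rw [mem_coe, mem_filter] at hx
  rw [mem_coe, mem_filter]
  refine ⟨hUV x hx.1 x₀ hx₀.1, fun l hl => ?_⟩
  have hcell : cell x ⟨l, hl⟩ = cell x₀ ⟨l, hl⟩ := by rw [hx.2, hx₀.2]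
  simp only [cell, Prod.mk.injEq] at hcell
  have hhalf : ∀ r s : ℝ, ⌊r / (θ / 2)⌋ = ⌊s / (θ / 2)⌋ → |r - s| ≤ θ / 2 := by
    intro r s h
    have := Int.abs_sub_lt_one_of_floor_eq_floor h
    rw [← sub_div, abs_div, abs_of_pos (by positivity : 0 < θ / 2), div_lt_one (by positivity)] at this
    exact this.le
  have h1 : ‖1 - l (x - x₀)‖ = ‖l x - l x₀‖ := by
    have : l x - l x₀ = -(l x₀ * (1 - l (x - x₀))) := by
      have : l x = l x₀ * l (x - x₀) := by rw [← AddChar.map_add_eq_mul, add_sub_cancel]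
      rw [this]; ring
    rw [this, norm_neg, norm_mul, AddChar.norm_apply, one_mul]
  rw [h1]
  refine (Complex.norm_le_abs_re_add_abs_im _).trans ?_
  rw [Complex.sub_re, Complex.sub_im]
  linarith [hhalf _ _ hcell.1, hhalf _ _ hcell.2]

/-- Large Fourier coefficients of a set that grows little come from characters that are almost
trivial on small shifts. -/
theorem norm_one_sub_le_of_charMean {G : Type*} [AddCommGroup G] [Finite G] {Z Z' : Finset G}
    (hZ : Z.Nonempty) {ε : ℝ} (hZZ : Z ⊆ Z') (hcard : (#Z' : ℝ) ≤ (1 + ε) * #Z) {x : G}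
    (hx : ∀ z ∈ Z, z + x ∈ Z') {ψ : AddChar G ℂ} (hψ : 1 / 2 ≤ ‖charMean Z ψ‖) :
    ‖1 - ψ x‖ ≤ 4 * ε := by
  classical
  have : Fintype G := Fintype.ofFinite G
  have hZ0 : (0 : ℝ) < #Z := Nat.cast_pos.2 hZ.card_pos
  -- Both `Z` and `Z + x` fill `Z'` up to ε · #Z points, so the sums of ψ over them differ by at
  -- most 2ε · #Z. That difference is (1 - ψ x) times a sum of modulus at least #Z / 2.
  have hsub : ∀ U ⊆ Z', #U = #Z → ‖∑ z ∈ Z', ψ z - ∑ z ∈ U, ψ z‖ ≤ ε * #Z := by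
    intro U hU hUc
    rw [← sum_sdiff hU, add_sub_cancel_right]
    refine (norm_sum_le _ _).trans ?_
    have h1 : (#(Z' \ U) : ℝ) = #Z' - #Z := by
      rw [card_sdiff_of_subset hU, Nat.cast_sub (card_le_card hU), hUc]
    simp only [AddChar.norm_apply, sum_const, nsmul_eq_mul, mul_one]
    rw [h1]; linarith
  have h1 := hsub Z hZZ rfl
  have h2 := hsub (Z.map (addRightEmbedding x)) (fun y hy => by
    obtain ⟨z, hz, rfl⟩ := mem_map.1 hy
    exact hx z hz) (card_map _)
  have h3 : ∑ z ∈ Z.map (addRightEmbedding x), ψ z = ψ x * ∑ z ∈ Z, ψ z := by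
    rw [sum_map, mul_sum]
    exact sum_congr rfl fun z _ => by
      rw [addRightEmbedding_apply, AddChar.map_add_eq_mul, mul_comm]
  have h4 : ‖1 - ψ x‖ * ‖∑ z ∈ Z, ψ z‖ ≤ 2 * (ε * #Z) := by
    rw [← norm_mul]
    have : (1 - ψ x) * ∑ z ∈ Z, ψ z = (∑ z ∈ Z', ψ z - ψ x * ∑ z ∈ Z, ψ z) -
        (∑ z ∈ Z', ψ z - ∑ z ∈ Z, ψ z) := by ring
    rw [this]
    rw [h3] at h2
    exact (norm_sub_le _ _).trans (by linarith)
  have h5 : (#Z : ℝ) / 2 ≤ ‖∑ z ∈ Z, ψ z‖ := by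
    rw [charMean, norm_div, RCLike.norm_natCast, le_div_iff₀ hZ0] at hψ
    linarith
  have h6 : ‖1 - ψ x‖ * (#Z / 2) ≤ 2 * (ε * #Z) :=
    (mul_le_mul_of_nonneg_left h5 (norm_nonneg _)).trans h4
  have h7 : ‖1 - ψ x‖ * #Z ≤ 4 * ε * #Z := by linarith
  exact le_of_mul_le_mul_right h7 hZ0

/-! ### Balls, densities, regular dilates and refinements of Bohr sets -/

namespace BohrSet

variable {G : Type*} [AddCommGroup G] [Fintype G]

open scoped Classical in
/-- The points of the dilate of a Bohr set, as a finite set. -/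
noncomputable def ball (B : BohrSet G) (ρ : ℝ) : Finset G :=
  univ.filter fun x => ∀ γ ∈ B.freq, ‖1 - γ x‖ ≤ ρ * B.width γ

theorem mem_ball {B : BohrSet G} {ρ : ℝ} {x : G} :
    x ∈ B.ball ρ ↔ ∀ γ ∈ B.freq, ‖1 - γ x‖ ≤ ρ * B.width γ := by
  simp [ball]

/-- The cap at 2 is no restriction, since values of characters are at distance at most 2 from 1. -/
theorem coe_ball (B : BohrSet G) (ρ : ℝ) : (B.ball ρ : Set G) = B.dilate ρ := by
  ext x
  rw [mem_coe, mem_ball, dilate, Set.mem_ofPred_eq]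
  refine forall₂_congr fun γ _ => ?_
  have : ‖1 - γ x‖ ≤ 2 := by
    refine (norm_sub_le _ _).trans ?_
    rw [AddChar.norm_apply, norm_one]; norm_num
  simp [this]

theorem coe_ball_one (B : BohrSet G) : (B.ball 1 : Set G) = B.carrier := by
  ext x
  rw [mem_coe, mem_ball, carrier, Set.mem_ofPred_eq]
  simp

theorem ball_mono (B : BohrSet G) {ρ σ : ℝ} (h : ρ ≤ σ) : B.ball ρ ⊆ B.ball σ := by
  intro x hx
  rw [mem_ball] at hx ⊢
  exact fun γ hγ => (hx γ hγ).trans (mul_le_mul_of_nonneg_right h (B.width_pos γ hγ).le)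

theorem zero_mem_ball (B : BohrSet G) {ρ : ℝ} (h : 0 ≤ ρ) : 0 ∈ B.ball ρ := by
  rw [mem_ball]
  intro γ hγ
  simpa using mul_nonneg h (B.width_pos γ hγ).le

theorem ball_nonempty (B : BohrSet G) {ρ : ℝ} (h : 0 ≤ ρ) : (B.ball ρ).Nonempty :=
  ⟨0, B.zero_mem_ball h⟩

theorem card_ball_pos (B : BohrSet G) {ρ : ℝ} (h : 0 ≤ ρ) : (0 : ℝ) < #(B.ball ρ) :=
  Nat.cast_pos.2 (B.ball_nonempty h).card_pos

theorem add_mem_ball {B : BohrSet G} {ρ σ : ℝ} {x y : G} (hx : x ∈ B.ball ρ) (hy : y ∈ B.ball σ) :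
    x + y ∈ B.ball (ρ + σ) := by
  rw [mem_ball] at hx hy ⊢
  intro γ hγ
  rw [add_mul]
  exact (γ.norm_one_sub_add_le x y).trans (add_le_add (hx γ hγ) (hy γ hγ))

theorem neg_mem_ball {B : BohrSet G} {ρ : ℝ} {x : G} (hx : x ∈ B.ball ρ) : -x ∈ B.ball ρ := by
  rw [mem_ball] at hx ⊢
  intro γ hγ
  rw [γ.norm_one_sub_neg]
  exact hx γ hγ

theorem sub_mem_ball {B : BohrSet G} {ρ σ : ℝ} {x y : G} (hx : x ∈ B.ball ρ) (hy : y ∈ B.ball σ) :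
    x - y ∈ B.ball (ρ + σ) := by
  rw [sub_eq_add_neg]
  exact add_mem_ball hx (neg_mem_ball hy)

theorem sum_mem_ball {B : BohrSet G} {ρ : ℝ} {M : ℕ} {z : Fin M → G}
    (hz : ∀ i, z i ∈ B.ball ρ) : ∑ i, z i ∈ B.ball (M * ρ) := by
  induction M with
  | zero => simpa using B.zero_mem_ball (le_of_eq rfl)
  | succ M ih =>
    rw [Fin.sum_univ_succ]
    have := add_mem_ball (hz 0) (ih fun i => hz i.succ)
    convert this using 2
    push_cast; ring

end BohrSet

section
variable {G : Type*} [Fintype G]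

theorem uniformMean_coe (X : Finset G) (f : G → ℝ) :
    uniformMean (X : Set G) f = (∑ x ∈ X, f x) / #X := by
  classical
  rw [uniformMean, Set.ncard_coe_finset]
  congr 1
  simp [Set.indicator_apply, sum_ite_mem]

theorem relDensity_coe [DecidableEq G] (X Y : Finset G) :
    relDensity (X : Set G) (Y : Set G) = #(X ∩ Y) / #X := by
  rw [relDensity, uniformMean_coe]
  congr 1
  simp [ind, Set.indicator_apply, sum_ite_mem]

theorem relDensity_coe_of_subset {X Y : Finset G} (h : Y ⊆ X) :
    relDensity (X : Set G) (Y : Set G) = #Y / #X := by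
  classical
  rw [relDensity_coe, inter_eq_right.2 h]

theorem relDensity_univ_coe (Y : Finset G) :
    relDensity Set.univ (Y : Set G) = #Y / Fintype.card G := by
  rw [← coe_univ, relDensity_coe_of_subset (subset_univ _), card_univ]

end

namespace BohrSet

variable {G : Type*} [AddCommGroup G] [Fintype G]

theorem relDensity_dilate (B : BohrSet G) (ρ : ℝ) :
    relDensity Set.univ (B.dilate ρ) = #(B.ball ρ) / Fintype.card G := by
  rw [← coe_ball, relDensity_univ_coe]

theorem isDimensional_iff {B : BohrSet G} {d : ℝ} :
    B.IsDimensional d ↔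
      ∀ ρ : ℝ, 0 < ρ → ρ ≤ 1 → (#(B.ball (2 * ρ)) : ℝ) ≤ 2 ^ d * #(B.ball ρ) := by
  have hN : (0 : ℝ) < Fintype.card G := Nat.cast_pos.2 Fintype.card_pos
  refine forall₃_congr fun ρ _ _ => ?_
  rw [relDensity_dilate, relDensity_dilate, mul_div_assoc', div_le_div_iff_of_pos_right hN]

theorem relDensity_dilate_div (B : BohrSet G) (ρ σ : ℝ) :
    relDensity Set.univ (B.dilate ρ) / relDensity Set.univ (B.dilate σ) =
      #(B.ball ρ) / #(B.ball σ) := by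
  have hN : (Fintype.card G : ℝ) ≠ 0 := (Nat.cast_pos.2 Fintype.card_pos).ne'
  rw [relDensity_dilate, relDensity_dilate, div_div_div_cancel_right₀ hN]

theorem IsRegularOfDim.card_ball_le {B : BohrSet G} {C d η : ℝ} (h : B.IsRegularOfDim C d)
    (h0 : 0 ≤ η) (h1 : η ≤ 1 / (C * d)) :
    (#(B.ball (1 + η)) : ℝ) ≤ (1 + C * d * η) * #(B.ball 1) := by
  have := (h.2 η (by rwa [abs_of_nonneg h0])).2
  rw [relDensity_dilate_div, div_le_iff₀ (B.card_ball_pos zero_le_one), abs_of_nonneg h0] at this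
  exact this

theorem IsDimensional.exists_regular_radius {B : BohrSet G} {d r : ℝ} (h : B.IsDimensional d)
    (hd : 1 ≤ d) (hr : 0 < r) (hr1 : r ≤ 1) :
    ∃ ρ, r / 2 ≤ ρ ∧ ρ ≤ r ∧ ∀ η, 0 ≤ η → η ≤ 1 / (128 * d) →
      (#(B.ball (ρ * (1 + η))) : ℝ) ≤ (1 + 128 * d * η) * #(B.ball ρ) := by
  obtain ⟨ρ, h1, h2, h3⟩ := _root_.exists_regular_radius (fun ρ => #(B.ball ρ))
    (fun a b hab => card_le_card (B.ball_mono hab)) hr hd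
    (B.ball_nonempty (by positivity)).card_pos (by
      have := isDimensional_iff.1 h (r / 2) (by positivity) (by linarith)
      rwa [mul_div_cancel₀ _ two_ne_zero] at this)
  exact ⟨ρ, h1, h2, fun η h4 h5 => (h3 η h4 h5).1⟩

/-- Repeated halving from radius 1 to the power of 1/2 between δ/2 and δ. -/
theorem IsDimensional.le_card_ball {B : BohrSet G} {d δ : ℝ} (h : B.IsDimensional d)
    (hd : 0 ≤ d) (hδ : 0 < δ) (hδ1 : δ ≤ 1) :
    (δ / 2) ^ d * #(B.ball 1) ≤ (#(B.ball δ) : ℝ) := by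
  have hpow : ∀ j : ℕ, (#(B.ball 1) : ℝ) ≤ (2 ^ j : ℝ) ^ d * #(B.ball ((2 ^ j)⁻¹)) := by
    intro j
    induction j with
    | zero => simp
    | succ j ih =>
      have h1 := isDimensional_iff.1 h ((2 ^ (j + 1))⁻¹) (by positivity)
        (inv_le_one_of_one_le₀ (one_le_pow₀ one_le_two))
      have h2 : (2 : ℝ) * (2 ^ (j + 1))⁻¹ = (2 ^ j)⁻¹ := by
        rw [pow_succ]; field_simp
      rw [h2] at h1
      refine ih.trans ?_
      rw [pow_succ, Real.mul_rpow (by positivity) (by positivity), mul_assoc]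
      rw [pow_succ] at h1
      gcongr
  obtain ⟨j, hj1, hj2⟩ : ∃ j : ℕ, (2 ^ j)⁻¹ ≤ δ ∧ δ / 2 ≤ (2 ^ j)⁻¹ := by
    obtain ⟨j, hj1, hj2⟩ := exists_nat_pow_near_of_lt_one hδ hδ1 (y := (1 / 2 : ℝ)) (by norm_num) (by norm_num)
    refine ⟨j + 1, ?_, ?_⟩
    · rw [← inv_pow, ← one_div]; exact hj1.le
    · rw [← inv_pow, ← one_div, pow_succ]; linarith
  have h1 := hpow j
  have h2 : (#(B.ball ((2 ^ j)⁻¹)) : ℝ) ≤ #(B.ball δ) :=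
    Nat.cast_le.2 (card_le_card (B.ball_mono hj1))
  have h3 : (δ / 2) ^ d ≤ ((2 ^ j : ℝ) ^ d)⁻¹ := by
    rw [← Real.inv_rpow (by positivity)]
    exact Real.rpow_le_rpow (by positivity) hj2 hd
  have h4 : (0 : ℝ) < (2 ^ j : ℝ) ^ d := by positivity
  calc (δ / 2) ^ d * #(B.ball 1) ≤ ((2 ^ j : ℝ) ^ d)⁻¹ * ((2 ^ j : ℝ) ^ d * #(B.ball ((2 ^ j)⁻¹))) := by
        gcongr
    _ = #(B.ball ((2 ^ j)⁻¹)) := by rw [inv_mul_cancel_left₀ h4.ne']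
    _ ≤ _ := h2

/-- The Bohr set with all widths multiplied by `ρ`. -/
noncomputable def scale (B : BohrSet G) (ρ : ℝ) (h0 : 0 < ρ) (h1 : ρ ≤ 1) : BohrSet G where
  freq := B.freq
  width γ := ρ * B.width γ
  width_pos γ hγ := mul_pos h0 (B.width_pos γ hγ)
  width_le_two γ hγ := (mul_le_of_le_one_left (B.width_pos γ hγ).le h1).trans (B.width_le_two γ hγ)

theorem ball_scale (B : BohrSet G) {ρ : ℝ} (h0 : 0 < ρ) (h1 : ρ ≤ 1) (σ : ℝ) :
    (B.scale ρ h0 h1).ball σ = B.ball (ρ * σ) := by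
  ext x
  rw [mem_ball, mem_ball]
  refine forall₂_congr fun γ _ => ?_
  rw [show (B.scale ρ h0 h1).width γ = ρ * B.width γ from rfl, ← mul_assoc, mul_comm σ]

/-- Regularity must hold for every dimension of the dilate. The exponent `d₀` of the single doubling
from radius 1/2 to 1 (at least 1) suffices to find the radius, and it is a lower bound for each such
dimension. -/
theorem exists_isRegular_scale (B : BohrSet G) :
    ∃ ρ, ∃ h0 : 0 < ρ, ∃ h1 : ρ ≤ 1, 1 / 2 ≤ ρ ∧
      ∀ C : ℝ, 128 ≤ C → (B.scale ρ h0 h1).IsRegular C := by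
  have hhalf := B.card_ball_pos (ρ := 1 / 2) (by norm_num)
  have hone := B.card_ball_pos zero_le_one
  set q : ℝ := #(B.ball 1) / #(B.ball (1 / 2)) with hq
  have hq0 : 0 < q := by positivity
  set d₀ : ℝ := max 1 (Real.logb 2 q) with hd₀
  obtain ⟨ρ, h1, h2, h3⟩ := _root_.exists_regular_radius (fun ρ => #(B.ball ρ))
    (fun a b hab => card_le_card (B.ball_mono hab)) one_pos (le_max_left 1 (Real.logb 2 q))
    (B.ball_nonempty (by positivity)).card_pos (by
      rw [← div_le_iff₀ hhalf]
      calc q = 2 ^ Real.logb 2 q := (Real.rpow_logb (by norm_num) (by norm_num) hq0).symm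
        _ ≤ 2 ^ d₀ := Real.rpow_le_rpow_of_exponent_le one_le_two (le_max_right _ _))
  have hρ : 0 < ρ := by linarith
  refine ⟨ρ, hρ, h2, h1, fun C hC d hd hdim => ⟨hdim, fun η hη => ?_⟩⟩
  have hd₀d : d₀ ≤ d := by
    refine max_le hd ?_
    -- This radius of the dilate is radius 1/2 of `B`, and doubling it gives radius 1. It is
    -- admissible because ρ ≥ 1/2.
    have := isDimensional_iff.1 hdim (1 / (2 * ρ)) (by positivity) (by
      rw [div_le_one (by positivity)]; linarith)
    rw [ball_scale, ball_scale] at this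
    rw [show ρ * (2 * (1 / (2 * ρ))) = 1 by field_simp,
      show ρ * (1 / (2 * ρ)) = 1 / 2 by field_simp, ← div_le_iff₀ hhalf] at this
    rw [Real.logb_le_iff_le_rpow (by norm_num) hq0]
    exact this
  have hd₀1 : 1 ≤ d₀ := le_max_left _ _
  have hCd : 128 * d₀ ≤ C * d := by nlinarith
  have hη' : |η| ≤ 1 / (128 * d₀) :=
    hη.trans (one_div_le_one_div_of_le (by positivity) hCd)
  have hle : 1 + 128 * d₀ * |η| ≤ 1 + C * d * |η| := by
    have := mul_le_mul_of_nonneg_right hCd (abs_nonneg η)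
    linarith
  have hpos : 0 < 1 + 128 * d₀ * |η| := by positivity
  rw [relDensity_dilate_div, ball_scale, ball_scale, mul_one]
  obtain ⟨hup, hlo⟩ := h3 |η| (abs_nonneg _) hη'
  have hρ0 := B.card_ball_pos hρ.le
  have hη1 : |η| ≤ 1 / 128 := hη'.trans (by
    apply one_div_le_one_div_of_le <;> linarith)
  have hcard : (#(B.ball (ρ * (1 + η))) : ℝ) ≤ (1 + C * d * |η|) * #(B.ball ρ) := by
    refine le_trans (Nat.cast_le.2 (card_le_card (B.ball_mono ?_))) (hup.trans ?_)
    · exact mul_le_mul_of_nonneg_left (by linarith [le_abs_self η]) hρ.le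
    · gcongr
  have hcard2 : (#(B.ball ρ) : ℝ) ≤ (1 + C * d * |η|) * #(B.ball (ρ * (1 + η))) := by
    refine hlo.trans ?_
    gcongr
    exact B.ball_mono (mul_le_mul_of_nonneg_left (by linarith [neg_abs_le η]) hρ.le)
  constructor
  · rw [div_le_div_iff₀ (by linarith) hρ0]
    linarith
  · rw [div_le_iff₀ hρ0]
    exact hcard

open scoped Classical in
/-- Narrow the widths of `B` by the factor `r` and add the frequencies in `Λ` with width `θ`. -/
noncomputable def refine (B : BohrSet G) (Λ : Finset (AddChar G ℂ)) (r θ : ℝ) (hr : 0 < r) (hr1 : r ≤ 1)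
    (hθ : 0 < θ) (hθ2 : θ ≤ 2) : BohrSet G where
  freq := B.freq ∪ Λ
  width γ := if γ ∈ B.freq then (if γ ∈ Λ then min (r * B.width γ) θ else r * B.width γ) else θ
  width_pos γ _ := by
    split_ifs with h1 h2
    · exact lt_min (mul_pos hr (B.width_pos γ h1)) hθ
    · exact mul_pos hr (B.width_pos γ h1)
    · exact hθ
  width_le_two γ _ := by
    split_ifs with h1 h2
    · exact (min_le_right _ _).trans hθ2
    · exact (mul_le_of_le_one_left (B.width_pos γ h1).le hr1).trans (B.width_le_two γ h1)
    · exact hθ2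

theorem mem_ball_refine {B : BohrSet G} {Λ : Finset (AddChar G ℂ)} {r θ : ℝ} {hr : 0 < r}
    {hr1 : r ≤ 1} {hθ : 0 < θ} {hθ2 : θ ≤ 2} {ρ : ℝ} (hρ : 0 ≤ ρ) {x : G} :
    x ∈ (B.refine Λ r θ hr hr1 hθ hθ2).ball ρ ↔
      x ∈ B.ball (ρ * r) ∧ ∀ l ∈ Λ, ‖1 - l x‖ ≤ ρ * θ := by
  classical
  rw [mem_ball, mem_ball]
  simp only [refine, mem_union]
  constructor
  · intro h
    refine ⟨fun γ hγ => ?_, fun l hl => ?_⟩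
    · have := h γ (Or.inl hγ)
      rw [if_pos hγ] at this
      rw [mul_assoc]
      split_ifs at this
      · exact this.trans (mul_le_mul_of_nonneg_left (min_le_left _ _) hρ)
      · exact this
    · have := h l (Or.inr hl)
      rw [if_pos hl] at this
      split_ifs at this
      · exact this.trans (mul_le_mul_of_nonneg_left (min_le_right _ _) hρ)
      · exact this
  · rintro ⟨h1, h2⟩ γ hγ
    split_ifs with h3 h4
    · rw [mul_min_of_nonneg _ _ hρ, ← mul_assoc]
      exact le_min (h1 γ h3) (h2 γ h4)
    · rw [← mul_assoc]; exact h1 γ h3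
    · exact h2 γ (hγ.resolve_left h3)

end BohrSet

/-! ### Correlations with a set having no density increment -/

theorem ind_coe {G : Type*} [DecidableEq G] (A : Finset G) (x : G) :
    ind (A : Set G) x = if x ∈ A then 1 else 0 := by
  simp [ind, Set.indicator_apply]

theorem sum_ind_coe {G : Type*} [Fintype G] (A : Finset G) : ∑ x, ind (A : Set G) x = #A := by
  classical
  simp [ind_coe]

section
variable {G : Type*} [AddCommGroup G] [Fintype G]

theorem convOn_coe (D : Finset G) (f : G → ℝ) (x : G) :
    convOn (D : Set G) f (fun _ => 1) x = (∑ t ∈ D, f (x - t)) / #D := by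
  rw [convOn, uniformMean_coe]
  simp

theorem sum_convOn_coe {D : Finset G} (hD : D.Nonempty) (f : G → ℝ) :
    ∑ x, convOn (D : Set G) f (fun _ => 1) x = ∑ x, f x := by
  have hD0 : (#D : ℝ) ≠ 0 := (Nat.cast_pos.2 hD.card_pos).ne'
  simp only [convOn_coe]
  rw [← sum_div, sum_comm]
  have : ∀ t ∈ D, ∑ x, f (x - t) = ∑ x, f x := fun t _ =>
    Equiv.sum_comp (Equiv.subRight t) f
  rw [sum_congr rfl this, sum_const, nsmul_eq_mul, mul_div_cancel_left₀ _ hD0]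

/-- If the density of `A` on translates of `D` is at most `κ`, then correlations with `A` are large
on average over `D`. -/
theorem exists_le_shiftCorr {f : G → ℝ} (hf1 : ∀ x, f x ≤ 1)
    {A S D R : Finset G} (hS : S.Nonempty) (hD : D.Nonempty) {κ : ℝ}
    (hκ : ∀ x, convOn (D : Set G) (ind (A : Set G)) (fun _ => 1) x ≤ κ)
    (hfR : ∀ x ∉ R, f x = 0) (hR : ∀ a ∈ A, ∀ t ∈ D, ∀ z ∈ S, a + t - z ∈ R) :
    ∃ t ∈ D, #A - κ * (#R - ∑ x, f x) ≤ shiftCorr f A S t := by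
  classical
  have hS0 : (0 : ℝ) < #S := Nat.cast_pos.2 hS.card_pos
  have hD0 : (0 : ℝ) < #D := Nat.cast_pos.2 hD.card_pos
  set g := convOn (D : Set G) (ind (A : Set G)) (fun _ => 1) with hg
  -- `u` is 1_A ∗ μ_D ∗ μ_{-S}: bounded by κ, of total mass #A and supported in `R`. The mean of the
  -- correlation over `D` is the sum of f · u, which equals #A minus the sum of (1 - f) · u over
  -- `R`.
  let u : G → ℝ := fun y => (∑ z ∈ S, g (y + z)) / #S
  have huκ : ∀ y, u y ≤ κ := fun y => by
    simp only [u]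
    rw [div_le_iff₀ hS0]
    calc ∑ z ∈ S, g (y + z) ≤ ∑ z ∈ S, κ := sum_le_sum fun z _ => hκ _
      _ = _ := by simp [mul_comm]
  have husum : ∑ y, u y = #A := by
    simp only [u]
    rw [← sum_div, sum_comm]
    have : ∀ z ∈ S, ∑ y, g (y + z) = #A := fun z _ => by
      rw [← sum_ind_coe A, ← sum_convOn_coe hD (ind (A : Set G)), ← hg]
      exact Equiv.sum_comp (Equiv.addRight z) g
    rw [sum_congr rfl this, sum_const, nsmul_eq_mul, mul_div_cancel_left₀ _ hS0.ne']
  have huR : ∀ y ∉ R, u y = 0 := fun y hy => by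
    simp only [u]
    rw [sum_eq_zero, zero_div]
    intro z hz
    rw [hg, convOn_coe, sum_eq_zero, zero_div]
    intro t ht
    rw [ind_coe, if_neg]
    intro ha
    apply hy
    have := hR _ ha t ht z hz
    rwa [show y + z - t + t - z = y by abel] at this
  have hsum : ∑ t ∈ D, shiftCorr f A S t = #D * ∑ y, f y * u y := by
    have h1 : ∀ t ∈ D, shiftCorr f A S t =
        ∑ y, f y * ((∑ z ∈ S, ind (A : Set G) (y + z - t)) / #S) := by
      intro t _
      simp only [mul_div_assoc', mul_sum]
      rw [shiftCorr, ← sum_div, ← sum_div, sum_comm, sum_comm (s := (univ : Finset G))]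
      congr 1
      refine sum_congr rfl fun z _ => ?_
      rw [← Equiv.sum_comp (Equiv.addRight (t - z)) (fun y => f y * ind (A : Set G) (y + z - t))]
      simp only [Equiv.coe_addRight, ind_coe]
      have : ∀ x : G, x + (t - z) + z - t = x := fun x => by abel
      simp [this, add_sub_assoc]
    rw [sum_congr rfl h1, sum_comm, mul_sum]
    refine sum_congr rfl fun y _ => ?_
    have hg' : ∀ w, #D * g w = ∑ t ∈ D, ind (A : Set G) (w - t) := fun w => by
      rw [hg, convOn_coe, mul_div_cancel₀ _ hD0.ne']
    have hu : #D * u y = (∑ t ∈ D, ∑ z ∈ S, ind (A : Set G) (y + z - t)) / #S := by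
      simp only [u]
      rw [mul_div_assoc', mul_sum, sum_comm]
      simp only [hg']
    rw [mul_left_comm, hu, ← mul_sum, sum_div]
  have hlow : #A - κ * (#R - ∑ x, f x) ≤ ∑ y, f y * u y := by
    have h1 : ∑ y, u y = ∑ y ∈ R, u y := (sum_subset (subset_univ R) fun y _ h => huR y h).symm
    have h2 : ∑ y, f y = ∑ y ∈ R, f y := (sum_subset (subset_univ R) fun y _ h => hfR y h).symm
    have h3 : ∑ y, f y * u y = ∑ y ∈ R, f y * u y :=
      (sum_subset (subset_univ R) fun y _ h => by rw [hfR y h, zero_mul]).symm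
    have h4 : (#R : ℝ) - ∑ y ∈ R, f y = ∑ y ∈ R, (1 - f y) := by simp
    rw [← husum, h1, h2, h3, h4, mul_sum, ← sum_sub_distrib]
    refine sum_le_sum fun y _ => ?_
    nlinarith [mul_le_mul_of_nonneg_left (huκ y) (sub_nonneg.2 (hf1 y))]
  by_contra! hcon
  have := sum_lt_sum_of_nonempty hD hcon
  rw [hsum, sum_const, nsmul_eq_mul] at this
  have := lt_of_mul_lt_mul_left this hD0.le
  linarith

theorem norm_fourierSum_shiftCorr_le {f : G → ℝ} {A S : Finset G} (γ : AddChar G ℂ) :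
    ‖fourierSum (fun v => (shiftCorr f A S v : ℂ)) γ‖ ≤
      ‖fourierSum (fun v => (f v : ℂ)) γ‖ * ‖∑ x ∈ A, γ x‖ := by
  have h1 : fourierSum (fun v => (shiftCorr f A S v : ℂ)) γ =
      fourierSum (fun v => (f v : ℂ)) γ * (∑ x ∈ A, γ (-x)) * charMean S γ := by
    have h2 : ∀ v, (shiftCorr f A S v : ℂ) * γ v =
        (∑ x ∈ A, ∑ z ∈ S, (f (v + (x - z)) : ℂ) * γ v) / #S := by
      intro v
      rw [shiftCorr, ← sum_div]
      push_cast
      rw [div_mul_eq_mul_div, sum_mul]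
      congr 1
      refine sum_congr rfl fun x _ => ?_
      rw [sum_mul]
      refine sum_congr rfl fun z _ => ?_
      rw [show x + v - z = v + (x - z) by abel]
    rw [fourierSum]
    simp only [h2]
    rw [← sum_div, sum_comm, charMean, mul_div_assoc']
    congr 1
    rw [mul_assoc, sum_mul_sum, mul_sum]
    refine sum_congr rfl fun x _ => ?_
    rw [sum_comm, mul_sum]
    refine sum_congr rfl fun z _ => ?_
    rw [fourierSum_shift (fun v => (f v : ℂ)), neg_sub, sub_eq_neg_add, AddChar.map_add_eq_mul]
    ring
  have h3 : ‖∑ x ∈ A, γ (-x)‖ = ‖∑ x ∈ A, γ x‖ := by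
    rw [← Complex.norm_conj, map_sum]
    simp only [AddChar.map_neg_eq_conj, Complex.conj_conj]
  rw [h1, norm_mul, norm_mul, h3]
  exact mul_le_of_le_one_right (by positivity) (norm_charMean_le_one S γ)

theorem fourierSum_ind (A : Finset G) (γ : AddChar G ℂ) :
    fourierSum (fun v => (ind (A : Set G) v : ℂ)) γ = ∑ x ∈ A, γ x := by
  classical
  simp [fourierSum, ind_coe, apply_ite]

theorem fourierSum_convOn (D : Finset G) (f : G → ℝ) (γ : AddChar G ℂ) :
    fourierSum (fun v => (convOn (D : Set G) f (fun _ => 1) v : ℂ)) γ =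
      charMean D γ * fourierSum (fun v => (f v : ℂ)) γ := by
  have h2 : ∀ v, (convOn (D : Set G) f (fun _ => 1) v : ℂ) * γ v =
      (∑ t ∈ D, (f (v + -t) : ℂ) * γ v) / #D := by
    intro v
    rw [convOn_coe]
    push_cast
    rw [div_mul_eq_mul_div, sum_mul]
    simp only [sub_eq_add_neg]
  rw [fourierSum]
  simp only [h2]
  rw [← sum_div, sum_comm, charMean, div_mul_eq_mul_div, sum_mul]
  congr 1
  refine sum_congr rfl fun t _ => ?_
  rw [fourierSum_shift (fun v => (f v : ℂ)), neg_neg]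

/-- Parseval with f² ≤ κ f. For f = 1_A ∗ μ_D this converts a bound for densities on translates into
a gain of κ over the trivial energy. -/
theorem sum_norm_sq_fourierSum_le {f : G → ℝ} (hf0 : ∀ x, 0 ≤ f x) {κ : ℝ} (hf : ∀ x, f x ≤ κ) :
    ∑ γ : AddChar G ℂ, ‖fourierSum (fun v => (f v : ℂ)) γ‖ ^ 2 ≤
      Fintype.card G * (κ * ∑ x, f x) := by
  rw [sum_norm_sq_fourierSum, mul_sum _ _ κ]
  gcongr with x
  rw [Complex.norm_real, Real.norm_of_nonneg (hf0 x), sq]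
  exact mul_le_mul_of_nonneg_right (hf x) (hf0 x)

/-- Spectral estimate for the variation of correlations along directions in which the large
spectrum of `T` is almost trivial. -/
theorem abs_shiftCorr_sub_le {f : G → ℝ} (hf0 : ∀ x, 0 ≤ f x) (hf1 : ∀ x, f x ≤ 1)
    {A S T D : Finset G} (hT : T.Nonempty) (hD : D.Nonempty) {κ η a e : ℝ} (hη : η ≤ 1 / 2)
    (ha : 0 < a)
    (hκ : ∀ x, convOn (D : Set G) (ind (A : Set G)) (fun _ => 1) x ≤ κ)
    (hspec : ∀ γ : AddChar G ℂ, 1 / 2 ≤ ‖charMean T γ‖ → ∀ t ∈ D, ‖1 - γ t‖ ≤ η)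
    (hper : ∀ v, ∀ y ∈ T, ∀ y' ∈ T, |shiftCorr f A S (v + y - y') - shiftCorr f A S v| ≤ e)
    (l : ℕ) {t : G} (ht : t ∈ D) :
    |shiftCorr f A S t - shiftCorr f A S 0| ≤ 2 * l * e + (1 / 4) ^ l * (∑ x, f x + #A) +
      η / 2 * (a * ∑ x, f x + 4 / a * (κ * #A)) := by
  classical
  have hN : (0 : ℝ) < Fintype.card G := Nat.cast_pos.2 Fintype.card_pos
  have hD0 : (0 : ℝ) < #D := Nat.cast_pos.2 hD.card_pos
  have hη0 : 0 ≤ η := by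
    have := hspec 1 (by
      have : (#T : ℂ) ≠ 0 := by simpa using hT.ne_empty
      simp [charMean, this]; norm_num) t ht
    simpa using this
  set fh : AddChar G ℂ → ℝ := fun γ => ‖fourierSum (fun v => (f v : ℂ)) γ‖ with hfh
  set ah : AddChar G ℂ → ℝ := fun γ => ‖∑ x ∈ A, γ x‖ with hah
  have hf2 : ∑ γ, fh γ ^ 2 ≤ Fintype.card G * ∑ x, f x := by
    simpa using sum_norm_sq_fourierSum_le hf0 hf1
  have ha2 : ∑ γ, ah γ ^ 2 ≤ Fintype.card G * #A := by
    have := sum_norm_sq_fourierSum_le (f := ind (A : Set G)) (κ := 1)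
      (fun x => by rw [ind_coe]; split_ifs <;> norm_num)
      (fun x => by rw [ind_coe]; split_ifs <;> norm_num)
    simpa only [fourierSum_ind, sum_ind_coe, one_mul] using this
  have had2 : ∑ γ, (‖charMean D γ‖ * ah γ) ^ 2 ≤ Fintype.card G * (κ * #A) := by
    have := sum_norm_sq_fourierSum_le (f := convOn (D : Set G) (ind (A : Set G)) (fun _ => 1))
      (fun x => by
        rw [convOn_coe]
        refine div_nonneg (sum_nonneg fun t _ => ?_) hD0.le
        rw [ind_coe]; split_ifs <;> norm_num) hκ
    simpa only [fourierSum_convOn, fourierSum_ind, sum_convOn_coe hD, sum_ind_coe, norm_mul]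
      using this
  -- As γ is nearly 1 on `D`, passing from 1_A to 1_A ∗ μ_D at most halves its coefficient on the
  -- large spectrum. The energy bound `had2` thus applies there at the cost of a factor 4.
  have hbig : ∀ γ : AddChar G ℂ, 1 / 2 ≤ ‖charMean T γ‖ → 1 / 2 ≤ ‖charMean D γ‖ := by
    intro γ hγ
    have h1 : ‖1 - charMean D γ‖ ≤ η := by
      have : 1 - charMean D γ = (∑ t ∈ D, (1 - γ t)) / #D := by
        have : (#D : ℂ) ≠ 0 := by exact_mod_cast hD0.ne'
        rw [charMean, sum_sub_distrib, sum_const, nsmul_eq_mul]; field_simp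
      rw [this, norm_div, RCLike.norm_natCast, div_le_iff₀ hD0]
      refine (norm_sum_le_of_le _ (hspec γ hγ)).trans (le_of_eq ?_)
      rw [sum_const, nsmul_eq_mul, mul_comm]
    have h2 : (1 : ℝ) ≤ ‖1 - charMean D γ‖ + ‖charMean D γ‖ := by
      simpa using norm_add_le (1 - charMean D γ) (charMean D γ)
    linarith
  have hterm : ∀ γ : AddChar G ℂ, ‖fourierSum (fun v => (shiftCorr f A S v : ℂ)) γ‖ *
      ‖charMean T γ‖ ^ (2 * l) * ‖1 - γ t‖ ≤
      (1 / 4) ^ l * (fh γ ^ 2 + ah γ ^ 2) +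
        η / 2 * (a * fh γ ^ 2 + 4 / a * (‖charMean D γ‖ * ah γ) ^ 2) := by
    intro γ
    have h0 := norm_fourierSum_shiftCorr_le (f := f) (A := A) (S := S) γ
    have hfn : 0 ≤ fh γ := norm_nonneg _
    have han : 0 ≤ ah γ := norm_nonneg _
    have hr : 0 ≤ η / 2 * (a * fh γ ^ 2 + 4 / a * (‖charMean D γ‖ * ah γ) ^ 2) := by positivity
    have hl : 0 ≤ (1 / 4 : ℝ) ^ l * (fh γ ^ 2 + ah γ ^ 2) := by positivity
    by_cases hγ : 1 / 2 ≤ ‖charMean T γ‖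
    · have h1 : ‖charMean T γ‖ ^ (2 * l) ≤ 1 := pow_le_one₀ (norm_nonneg _) (norm_charMean_le_one T γ)
      have h2 := hspec γ hγ t ht
      have h3 := hbig γ hγ
      -- Weighted AM–GM: the free weight `a` later balances the energies of `f` and of the smoothed
      -- `A`.
      have h4 : fh γ * ah γ ≤ (a * fh γ ^ 2 + 4 / a * (‖charMean D γ‖ * ah γ) ^ 2) / 2 := by
        have h5 : ah γ ^ 2 ≤ 4 * (‖charMean D γ‖ * ah γ) ^ 2 := by
          have : (1 / 2) ^ 2 ≤ ‖charMean D γ‖ ^ 2 := pow_le_pow_left₀ (by norm_num) h3 2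
          nlinarith [sq_nonneg (ah γ)]
        have h6 : 2 * (fh γ * ah γ) ≤ a * fh γ ^ 2 + 1 / a * ah γ ^ 2 := by
          have h7 : 0 ≤ (a * fh γ - ah γ) ^ 2 / a := by positivity
          have h8 : (a * fh γ - ah γ) ^ 2 / a =
              a * fh γ ^ 2 + 1 / a * ah γ ^ 2 - 2 * (fh γ * ah γ) := by field_simp; ring
          linarith
        have h9 : 1 / a * ah γ ^ 2 ≤ 4 / a * (‖charMean D γ‖ * ah γ) ^ 2 := by
          calc 1 / a * ah γ ^ 2 ≤ 1 / a * (4 * (‖charMean D γ‖ * ah γ) ^ 2) := by gcongr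
            _ = _ := by ring
        linarith
      calc _ ≤ (fh γ * ah γ) * 1 * η := by gcongr
        _ ≤ η / 2 * (a * fh γ ^ 2 + 4 / a * (‖charMean D γ‖ * ah γ) ^ 2) := by
          nlinarith [mul_le_mul_of_nonneg_left h4 hη0]
        _ ≤ _ := by linarith
    · have h1 : ‖charMean T γ‖ ^ (2 * l) ≤ (1 / 4) ^ l := by
        rw [pow_mul]
        refine pow_le_pow_left₀ (by positivity) ?_ l
        push Not at hγ
        nlinarith [norm_nonneg (charMean T γ)]
      have h2 : ‖1 - γ t‖ ≤ 2 := by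
        refine (norm_sub_le _ _).trans ?_
        rw [AddChar.norm_apply, norm_one]; norm_num
      calc _ ≤ (fh γ * ah γ) * (1 / 4) ^ l * 2 := by gcongr
        _ ≤ (1 / 4) ^ l * (fh γ ^ 2 + ah γ ^ 2) := by
          have : 2 * (fh γ * ah γ) ≤ fh γ ^ 2 + ah γ ^ 2 := by nlinarith [sq_nonneg (fh γ - ah γ)]
          have hp : (0 : ℝ) ≤ (1 / 4) ^ l := by positivity
          nlinarith [mul_le_mul_of_nonneg_left this hp]
        _ ≤ _ := by linarith
  have hmain := norm_sub_le_of_almost_periodic hT (fun v => (shiftCorr f A S v : ℂ)) (e := e)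
    (fun v y hy y' hy' => by
      rw [← Complex.ofReal_sub, Complex.norm_real]; exact hper v y hy y' hy') l t
  rw [← Complex.ofReal_sub, Complex.norm_real, Real.norm_eq_abs] at hmain
  refine hmain.trans ?_
  rw [add_assoc]
  gcongr
  rw [div_le_iff₀ hN]
  refine (sum_le_sum fun γ _ => hterm γ).trans ?_
  rw [sum_add_distrib, ← mul_sum, ← mul_sum, sum_add_distrib, sum_add_distrib, ← mul_sum, ← mul_sum]
  have hp : (0 : ℝ) ≤ (1 / 4) ^ l := by positivity
  calc _ ≤ (1 / 4) ^ l * (Fintype.card G * ∑ x, f x + Fintype.card G * #A) +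
        η / 2 * (a * (Fintype.card G * ∑ x, f x) + 4 / a * (Fintype.card G * (κ * #A))) := by
        gcongr
    _ = _ := by ring

end

/-! ### Construction of the Bohr set, and the lower bound without an increment -/

set_option maxHeartbeats 1000000 in
/-- A Bohr subset of `B'` of controlled rank and size on which the large spectrum of a set of
almost periods is almost trivial. -/
theorem exists_bohrSet_of_almost_periods {G : Type*} [AddCommGroup G] [Fintype G]
    {B' : BohrSet G} {CR d' : ℝ} (hCR : 128 ≤ CR) (hd' : 1 ≤ d') (hB' : B'.IsRegularOfDim CR d')
    {f : G → ℝ} (hf0 : ∀ x, 0 ≤ f x) (hf1 : ∀ x, f x ≤ 1) {A S R : Finset G} (hS : S.Nonempty)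
    (hSB : S ⊆ B'.ball 1) (hR : ∀ x ∉ R, ∀ z ∈ S, f (x - z) = 0)
    {n p m : ℕ} (hn : 0 < n) (hp : 0 < p) {E : ℝ} (hE0 : 0 ≤ E)
    (hE : (#A : ℝ) ^ (2 * p - 1) * (2 * #R * (6 * p / n) ^ p) ≤ E ^ (2 * p))
    (hm : 8 * (Real.log 8 + n * Real.log (2 * (#S / #(B'.ball 1) : ℝ)⁻¹)) < m)
    {η : ℝ} (hη : 0 < η) (hη2 : η ≤ 1 / 2) :
    ∃ (P : BohrSet G) (T : Finset G), P.IsRegular CR ∧ P.rank ≤ B'.rank + m ∧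
      P.ball 1 ⊆ B'.ball 1 ∧
      (η / (32 * m)) ^ (2 * m) * (η / (2 ^ 22 * CR * d' ^ 3 * m)) ^ d' * #(B'.ball 1) ≤
        (#(P.ball 1) : ℝ) ∧
      T.Nonempty ∧
      (∀ γ : AddChar G ℂ, 1 / 2 ≤ ‖charMean T γ‖ → ∀ t ∈ P.ball 1, ‖1 - γ t‖ ≤ η) ∧
      ∀ v, ∀ y ∈ T, ∀ y' ∈ T, |shiftCorr f A S (v + y - y') - shiftCorr f A S v| ≤ 2 * E := by
  classical
  have hCR0 : 0 < CR := by linarith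
  have hd0 : 0 < d' := by linarith
  have hB1 := B'.card_ball_pos zero_le_one
  have hS0 : (0 : ℝ) < #S := Nat.cast_pos.2 hS.card_pos
  have hn0 : (0 : ℝ) < n := Nat.cast_pos.2 hn
  have hσ : (#S / #(B'.ball 1) : ℝ) ≤ 1 :=
    div_le_one_of_le₀ (Nat.cast_le.2 (card_le_card hSB)) hB1.le
  have hm0 : (0 : ℝ) < m := by
    refine lt_of_le_of_lt ?_ hm
    have h1 : 0 ≤ Real.log 8 := Real.log_nonneg (by norm_num)
    have h2 : 0 ≤ Real.log (2 * (#S / #(B'.ball 1) : ℝ)⁻¹) := by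
      refine Real.log_nonneg ?_
      have := one_le_inv_iff₀.2 ⟨by positivity, hσ⟩
      linarith
    positivity
  have hm1 : (1 : ℝ) ≤ m := by exact_mod_cast Nat.cast_pos.1 hm0
  have hCd : 1 ≤ CR * d' := by nlinarith
  -- At this scale regularity of `B'` gives #(B' + Y) ≤ 2 · #B', which keeps the loss in sampling to
  -- 2^n.
  obtain ⟨ρY, hY1, hY2, hYreg⟩ := hB'.1.exists_regular_radius hd' (r := 1 / (CR * d'))
    (by positivity) (div_le_one_of_le₀ hCd (by positivity))
  have hρY : 0 < ρY := lt_of_lt_of_le (by positivity) hY1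
  have hρY1 : ρY ≤ 1 := hY2.trans (div_le_one_of_le₀ hCd (by positivity))
  -- Small enough that `m` summands from `Z` stay within the relative margin 1/(128 d') in which `Y`
  -- at most doubles.
  obtain ⟨ρZ, hZ1, hZ2, hZreg⟩ := hB'.1.exists_regular_radius hd' (r := ρY / (128 * d' * m))
    (by positivity) (div_le_one_of_le₀ (by nlinarith [mul_le_mul hd' hm1 zero_le_one hd0.le])
      (by positivity))
  have hρZ : 0 < ρZ := lt_of_lt_of_le (by positivity) hZ1
  have hρZ1 : ρZ ≤ 1 := hZ2.trans (div_le_one_of_le₀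
    (by nlinarith [mul_le_mul hd' hm1 zero_le_one hd0.le]) (by positivity))
  set Y := B'.ball ρY with hY
  set Z := B'.ball ρZ with hZ
  set Q := B'.ball (1 + ρY) with hQ
  have hQcard : (#Q : ℝ) ≤ 2 * #(B'.ball 1) := by
    refine (hB'.card_ball_le hρY.le hY2).trans ?_
    rw [le_div_iff₀ (by positivity)] at hY2
    gcongr
    linarith
  obtain ⟨T, hTY, hT, hTcard, hTper⟩ := exists_almost_periods (Y := Y) (Q := Q) hf0 hf1 hS
    (B'.ball_nonempty hρY.le) hR
    (fun z hz y hy => BohrSet.add_mem_ball (hSB hz) hy) hn hp hE0 hE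
  have hT0 : (0 : ℝ) < #T := Nat.cast_pos.2 hT.card_pos
  have hY0 : (0 : ℝ) < #Y := B'.card_ball_pos hρY.le
  have hlog : 8 * Real.log (4 * #Y / #T) < m := by
    refine lt_of_le_of_lt ?_ hm
    have h1 : 4 * (#Y : ℝ) / #T ≤ 8 * (2 * (#S / #(B'.ball 1) : ℝ)⁻¹) ^ n := by
      rw [div_le_iff₀ hT0, inv_div, mul_div_assoc', div_pow, mul_div_assoc', div_mul_eq_mul_div,
        le_div_iff₀ (by positivity)]
      have h2 : (#Q : ℝ) ^ n ≤ (2 * #(B'.ball 1)) ^ n := by gcongr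
      have h3 := mul_le_mul_of_nonneg_right h2 hT0.le
      linarith
    have h4 := Real.log_le_log (by positivity) h1
    rw [Real.log_mul (by norm_num) (by positivity), Real.log_pow] at h4
    linarith
  have hQ2 : (#(B'.ball (ρY * (1 + 1 / (128 * d')))) : ℝ) ≤ 2 * #Y := by
    refine (hYreg _ (by positivity) le_rfl).trans (le_of_eq ?_)
    have : 128 * d' * (1 / (128 * d')) = 1 := by field_simp
    rw [this]; norm_num
  obtain ⟨Λ, hΛ, hctrl⟩ := exists_spectrum_control (M := m) hTY hT (B'.ball_nonempty hρZ.le)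
    (Q := B'.ball (ρY * (1 + 1 / (128 * d')))) (fun y hy z hz => by
      refine B'.ball_mono ?_ (BohrSet.sub_mem_ball hy (BohrSet.sum_mem_ball hz))
      have : m * ρZ ≤ m * (ρY / (128 * d' * m)) := by gcongr
      have h2 : m * (ρY / (128 * d' * m)) = ρY * (1 / (128 * d')) := by field_simp
      linarith) hQ2 hlog
  -- The budget η is split evenly. Growth of `Z` contributes 4 · 128 d' δ = η/2, and the fewer than
  -- `m` characters of `Λ`, each with width θ = η/(2m), contribute at most η/2.
  set δ : ℝ := η / (1024 * d') with hδ
  have hδ0 : 0 < δ := by positivity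
  have hδ1 : δ ≤ 1 / (128 * d') := by
    rw [hδ, div_le_div_iff₀ (by positivity) (by positivity)]; nlinarith
  have hδ2 : δ ≤ 1 := hδ1.trans (div_le_one_of_le₀ (by linarith) (by positivity))
  set r : ℝ := ρZ * δ with hr
  have hr0 : 0 < r := by positivity
  have hr1 : r ≤ 1 := mul_le_one₀ hρZ1 hδ0.le hδ2
  set θ : ℝ := η / (2 * m) with hθ
  have hθ0 : 0 < θ := by positivity
  have hθ2 : θ ≤ 2 := (div_le_self hη.le (by linarith)).trans (by linarith)
  set pre := B'.refine Λ r θ hr0 hr1 hθ0 hθ2 with hpre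
  obtain ⟨ρ, hρ0, hρ1, hρh, hreg⟩ := pre.exists_isRegular_scale
  have hmem : ∀ x ∈ (pre.scale ρ hρ0 hρ1).ball 1, x ∈ B'.ball r ∧ ∀ l ∈ Λ, ‖1 - l x‖ ≤ θ := by
    intro x hx
    rw [BohrSet.ball_scale, mul_one] at hx
    have := pre.ball_mono hρ1 hx
    rw [hpre, BohrSet.mem_ball_refine zero_le_one, one_mul, one_mul] at this
    exact this
  refine ⟨pre.scale ρ hρ0 hρ1, T, hreg CR hCR, ?_, fun x hx => B'.ball_mono hr1 (hmem x hx).1, ?_,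
    hT, ?_, hTper⟩
  · have : (pre.scale ρ hρ0 hρ1).rank ≤ #B'.freq + #Λ := card_union_le _ _
    refine this.trans ?_
    have : B'.rank = #B'.freq := rfl
    omega
  -- The radii are halved because the regular dilate keeps at least half of each width. They are
  -- halved once more so that U - U fits.
  · have h1 := card_mul_pow_le_card_filter (U := B'.ball (r / 4)) (V := B'.ball (r / 2))
      (fun x hx y hy => B'.ball_mono (by linarith) (BohrSet.sub_mem_ball hx hy)) Λ
      (θ := θ / 2) (by positivity) (by linarith)
    have h2 : (B'.ball (r / 2)).filter (fun y => ∀ l ∈ Λ, ‖1 - l y‖ ≤ θ / 2) ⊆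
        (pre.scale ρ hρ0 hρ1).ball 1 := by
      intro x hx
      rw [mem_filter] at hx
      rw [BohrSet.ball_scale, mul_one]
      refine pre.ball_mono hρh ?_
      rw [hpre, BohrSet.mem_ball_refine (by norm_num)]
      refine ⟨by convert hx.1 using 2; ring, fun l hl => (hx.2 l hl).trans (by linarith)⟩
    have h3 := hB'.1.le_card_ball hd0.le (δ := r / 4) (by positivity) (by linarith)
    have h4 : (η / (2 ^ 22 * CR * d' ^ 3 * m)) ^ d' ≤ (r / 4 / 2) ^ d' := by
      refine Real.rpow_le_rpow (by positivity) ?_ hd0.le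
      have h5 : 1 / (CR * d') / 2 / (128 * d' * m) / 2 ≤ ρZ := by
        refine le_trans ?_ hZ1
        gcongr
      calc η / (2 ^ 22 * CR * d' ^ 3 * m)
          = 1 / (CR * d') / 2 / (128 * d' * m) / 2 * (η / (1024 * d')) / 4 / 2 := by
            field_simp; norm_num
        _ ≤ _ := by rw [hr, hδ]; gcongr
    have h6 : (η / (32 * m)) ^ (2 * m) ≤ (θ / 2 / 8) ^ (2 * #Λ) := by
      have h7 : θ / 2 / 8 = η / (32 * m) := by rw [hθ]; field_simp; norm_num
      rw [h7]
      refine pow_le_pow_of_le_one (by positivity) (div_le_one_of_le₀ (by linarith) (by positivity)) ?_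
      omega
    calc (η / (32 * m)) ^ (2 * m) * (η / (2 ^ 22 * CR * d' ^ 3 * m)) ^ d' * #(B'.ball 1)
        ≤ (θ / 2 / 8) ^ (2 * #Λ) * (r / 4 / 2) ^ d' * #(B'.ball 1) := by gcongr
      _ ≤ (θ / 2 / 8) ^ (2 * #Λ) * #(B'.ball (r / 4)) := by
          rw [mul_assoc]; gcongr
      _ ≤ _ := by rw [mul_comm]; exact h1
      _ ≤ _ := Nat.cast_le.2 (card_le_card h2)
  · intro γ hγ x hx
    obtain ⟨ψ, hψ, hle⟩ := hctrl γ hγ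
    obtain ⟨hx1, hx2⟩ := hmem x hx
    have h1 : ‖1 - ψ x‖ ≤ 4 * (128 * d' * δ) :=
      norm_one_sub_le_of_charMean (Z' := B'.ball (ρZ * (1 + δ))) (B'.ball_nonempty hρZ.le)
        (B'.ball_mono (le_mul_of_one_le_right hρZ.le (by linarith))) (hZreg δ hδ0.le hδ1)
        (fun z hz => by
          have := BohrSet.add_mem_ball hz hx1
          rwa [show ρZ + r = ρZ * (1 + δ) by rw [hr]; ring] at this) hψ
    have h2 : 4 * (128 * d' * δ) = η / 2 := by rw [hδ]; field_simp; norm_num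
    have h3 : ∑ l ∈ Λ, ‖1 - l x‖ ≤ η / 2 := by
      calc ∑ l ∈ Λ, ‖1 - l x‖ ≤ #Λ • θ := sum_le_card_nsmul _ _ _ hx2
        _ ≤ m * θ := by
            rw [nsmul_eq_mul]
            gcongr
        _ = η / 2 := by rw [hθ]; field_simp
    linarith [hle x]

/-- If the density of `A` on translates of `D` is at most `α(1 + cλ)`, with `D` a set on which the
large spectrum of a set of almost periods is almost trivial, then there are many solutions. -/
theorem le_shiftCorr_zero {G : Type*} [AddCommGroup G] [Fintype G] {B L A S T D R : Finset G}
    (hB : B.Nonempty) (hLB : L ⊆ B) (hAB : A ⊆ B) (hS : S.Nonempty) (hT : T.Nonempty)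
    (hD : D.Nonempty)
    {lam al c : ℝ} (hl0 : 0 < lam) (ha0 : 0 < al) (hlam : (#L : ℝ) = lam * #B)
    (hal : (#A : ℝ) = al * #B) (hc0 : 0 ≤ c) (hc : c ≤ 1 / 20)
    (hκ : ∀ x, convOn (D : Set G) (ind (A : Set G)) (fun _ => 1) x ≤ al * (1 + c * lam))
    (hLR : L ⊆ R) (hR : ∀ a ∈ A, ∀ t ∈ D, ∀ z ∈ S, a + t - z ∈ R)
    (hRB : (#R : ℝ) ≤ (1 + lam / 20) * #B) {l : ℕ} (hl : 0 < l)
    (hl2 : (1 / 4 : ℝ) ^ l ≤ lam * al / 40)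
    (hspec : ∀ γ : AddChar G ℂ, 1 / 2 ≤ ‖charMean T γ‖ → ∀ t ∈ D, ‖1 - γ t‖ ≤ lam / 60)
    (hper : ∀ v, ∀ y ∈ T, ∀ y' ∈ T, |shiftCorr (ind (L : Set G)) A S (v + y - y') -
      shiftCorr (ind (L : Set G)) A S v| ≤ 2 * (lam * #A / (40 * l))) :
    lam * #A / 2 ≤ shiftCorr (ind (L : Set G)) A S 0 := by
  classical
  have hB0 : (0 : ℝ) < #B := Nat.cast_pos.2 hB.card_pos
  have hl1 : lam ≤ 1 := by
    have h1 : (#L : ℝ) ≤ #B := Nat.cast_le.2 (card_le_card hLB)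
    rw [hlam] at h1
    exact le_of_mul_le_mul_right (by linarith) hB0
  have ha1 : al ≤ 1 := by
    have h1 : (#A : ℝ) ≤ #B := Nat.cast_le.2 (card_le_card hAB)
    rw [hal] at h1
    exact le_of_mul_le_mul_right (by linarith) hB0
  have hf0 : ∀ x, 0 ≤ ind (L : Set G) x := fun x => by rw [ind_coe]; split_ifs <;> norm_num
  have hf1 : ∀ x, ind (L : Set G) x ≤ 1 := fun x => by rw [ind_coe]; split_ifs <;> norm_num
  obtain ⟨t, ht, htF⟩ := exists_le_shiftCorr hf1 hS hD hκ
    (R := R) (fun x hx => by rw [ind_coe, if_neg fun h => hx (hLR h)]) hR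
  -- The weight is `al`: then al · #L and (4/al) · κ · #A are both O(al · #B), and no root of `al`
  -- is lost.
  have hvar := abs_shiftCorr_sub_le hf0 hf1 hT hD (by linarith : lam / 60 ≤ 1 / 2) ha0 hκ hspec hper
    l ht
  rw [sum_ind_coe] at htF hvar
  have hl0' : (0 : ℝ) < l := Nat.cast_pos.2 hl
  have e1 : 2 * l * (2 * (lam * #A / (40 * l))) = lam * #A / 10 := by field_simp; ring
  rw [e1] at hvar
  set N : ℝ := (#B : ℝ) with hN
  have hcl : c * lam ≤ 1 / 20 := by nlinarith
  have hclam : c * lam ≤ 1 / 20 * lam := by gcongr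
  have hprod : 0 < al * N := by positivity
  have hprod2 : 0 < lam * (al * N) := by positivity
  have e2 : (1 / 4 : ℝ) ^ l * (#L + #A) ≤ lam * (al * N) / 20 := by
    rw [hlam, hal]
    calc (1 / 4 : ℝ) ^ l * (lam * N + al * N) ≤ lam * al / 40 * (1 * N + 1 * N) := by gcongr
      _ = _ := by ring
  have e3 : lam / 60 / 2 * (al * #L + 4 / al * (al * (1 + c * lam) * #A)) ≤
      lam * (al * N) * (6 / 120) := by
    rw [hlam, hal]
    have : al * (lam * N) + 4 / al * (al * (1 + c * lam) * (al * N)) =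
        (al * N) * (lam + 4 * (1 + c * lam)) := by field_simp
    rw [this]
    have h2 : lam + 4 * (1 + c * lam) ≤ 6 := by linarith
    nlinarith [mul_le_mul_of_nonneg_left h2 hprod2.le]
  have e4 : lam * (al * N) * (9 / 10) - lam * (al * N) / 400 ≤
      #A - al * (1 + c * lam) * (#R - #L) := by
    have h1 : (#R : ℝ) - #L ≤ (1 - 19 / 20 * lam) * N := by rw [hlam]; linarith
    have h2 : al * (1 + c * lam) * (#R - #L) ≤
        al * (1 + 1 / 20 * lam) * ((1 - 19 / 20 * lam) * N) := by
      have hn1 : (0 : ℝ) ≤ 1 - 19 / 20 * lam := by linarith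
      calc al * (1 + c * lam) * (#R - #L) ≤ al * (1 + c * lam) * ((1 - 19 / 20 * lam) * N) := by
            gcongr
        _ ≤ _ := by gcongr
    rw [hal]
    nlinarith [mul_pos hl0 hprod2]
  rw [abs_le] at hvar
  -- In units of lam · #A, at least 9/10 - 1/400 survives at t. The variation from t to 0 is at most
  -- 1/10 + 1/20 + 1/20, leaving more than 1/2.
  have e5 : lam * (#A : ℝ) = lam * (al * N) := by rw [hal]
  linarith [hvar.2]

/-- The number of solutions as a correlation. -/
theorem innerOn_convOn_eq {G : Type*} [AddCommGroup G] [Fintype G] {B B' A S : Finset G}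
    (hAB : A ⊆ B) (hSB : S ⊆ B') (f : G → ℝ) :
    innerOn (B : Set G) (convOn (B' : Set G) f (ind (S : Set G))) (ind (A : Set G)) =
      #S / #B' * shiftCorr f A S 0 / #B := by
  classical
  rcases S.eq_empty_or_nonempty with rfl | hS
  · have : convOn (B' : Set G) f (ind ((∅ : Finset G) : Set G)) = fun _ => 0 := by
      funext x; simp [convOn, ind, uniformMean]
    rw [this]
    simp [innerOn, uniformMean]
  have hS0 : (#S : ℝ) ≠ 0 := (Nat.cast_pos.2 hS.card_pos).ne'
  rw [innerOn, uniformMean_coe]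
  congr 1
  have h1 : ∀ x, convOn (B' : Set G) f (ind (S : Set G)) x = (∑ z ∈ S, f (x - z)) / #B' := by
    intro x
    rw [convOn, uniformMean_coe]
    congr 1
    rw [← sum_subset hSB fun y _ hy => by rw [ind_coe, if_neg hy, mul_zero]]
    exact sum_congr rfl fun y hy => by rw [ind_coe, if_pos hy, mul_one]
  rw [← sum_subset hAB fun y _ hy => by rw [ind_coe, if_neg hy, mul_zero], shiftCorr, mul_sum]
  refine sum_congr rfl fun x hx => ?_
  rw [ind_coe, if_pos hx, mul_one, h1, add_zero]
  field_simp

/-! ### Numerical parameters -/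

/-- The lower bound for the size of the Bohr set in terms of `k` and `m` only. -/
theorem exists_size_exponent {CR K : ℝ} (hCR : 128 ≤ CR) (hK : 1 ≤ K) :
    ∃ C : ℝ, 0 ≤ C ∧ ∀ (k m : ℕ) (d lam C' : ℝ), 1 ≤ k → 1 ≤ m → 1 ≤ d → d ≤ K * k → 0 < lam →
      lam ≤ 1 → lam⁻¹ ≤ m → C ≤ C' →
      (1 / (2 * (k : ℝ) * (m : ℝ))) ^ (C' * ((k : ℝ) + (m : ℝ))) ≤
        (lam / 60 / (32 * m)) ^ (2 * m) * (lam / 60 / (2 ^ 22 * CR * d ^ 3 * m)) ^ d := by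
  have hCR0 : 0 < CR := by linarith
  have hK0 : 0 < K := by linarith
  obtain ⟨s, hs⟩ := pow_unbounded_of_one_lt (CR * K ^ 3) one_lt_two
  -- Since lam ≥ 1/m and d ≤ K k, the two bases are at least X^(-13) and X^(-(31+s)) with X = 2km.
  -- Their exponents are 2m and d ≤ K k.
  refine ⟨26 + (31 + s) * K, by positivity, ?_⟩
  intro k m d lam C' hk hm hd hdK hl0 hl1 hlm hC'
  have hk1 : (1 : ℝ) ≤ k := by exact_mod_cast hk
  have hm1 : (1 : ℝ) ≤ m := by exact_mod_cast hm
  have hd0 : 0 < d := by linarith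
  have hk0 : (0 : ℝ) < k := by linarith
  have hm0 : (0 : ℝ) < m := by linarith
  set X : ℝ := 2 * k * m with hX
  have hkm : 1 ≤ (k : ℝ) * m := by nlinarith
  have hX2 : 2 ≤ X := by rw [hX]; linarith
  have hX0 : 0 < X := by linarith
  have hX1 : 1 ≤ X := by linarith
  have hmX : (m : ℝ) ≤ X := by rw [hX]; nlinarith
  have hlam : 1 / (m : ℝ) ≤ lam := by
    rw [one_div]; exact inv_le_of_inv_le₀ hl0 hlm
  have hXinv : 0 < 1 / X := by positivity
  have hXinv1 : 1 / X ≤ 1 := (div_le_one hX0).2 hX1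
  have b1 : (1 / X) ^ 13 ≤ lam / 60 / (32 * m) := by
    have h1 : lam / 60 / (32 * m) ≥ 1 / (m : ℝ) / 60 / (32 * m) := by gcongr
    refine le_trans ?_ h1
    rw [div_pow, one_pow, div_div, div_div]
    refine one_div_le_one_div_of_le (by positivity) ?_
    calc (m : ℝ) * (60 * (32 * m)) ≤ 2 ^ 11 * m ^ 2 := by nlinarith [sq_nonneg (m : ℝ)]
      _ ≤ X ^ 11 * X ^ 2 := by gcongr
      _ = X ^ 13 := by ring
  have b2 : (1 / X) ^ (31 + s) ≤ lam / 60 / (2 ^ 22 * CR * d ^ 3 * m) := by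
    have h1 : 1 / (m : ℝ) / 60 / (2 ^ 22 * CR * (K * k) ^ 3 * m) ≤
        lam / 60 / (2 ^ 22 * CR * d ^ 3 * m) := by gcongr
    refine le_trans ?_ h1
    rw [div_pow, one_pow, div_div, div_div]
    refine one_div_le_one_div_of_le (by positivity) ?_
    calc (m : ℝ) * (60 * (2 ^ 22 * CR * (K * k) ^ 3 * m))
        = 60 * 2 ^ 22 * (CR * K ^ 3) * ((k : ℝ) ^ 3 * (m : ℝ) ^ 2) := by ring
      _ ≤ 2 ^ 6 * 2 ^ 22 * 2 ^ s * ((k : ℝ) ^ 3 * (m : ℝ) ^ 3) := by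
          have : (m : ℝ) ^ 2 ≤ m ^ 3 := pow_le_pow_right₀ hm1 (by norm_num)
          gcongr
          norm_num
      _ = 2 ^ (28 + s) * ((k : ℝ) * m) ^ 3 := by rw [pow_add]; ring
      _ ≤ X ^ (28 + s) * X ^ 3 := by
          have : (k : ℝ) * m ≤ X := by rw [hX]; linarith
          gcongr
      _ = X ^ (31 + s) := by rw [← pow_add]; congr 1; ring
  have c1 : (1 / X) ^ (26 * (m : ℝ)) ≤ (lam / 60 / (32 * m)) ^ (2 * m) := by
    have : (1 / X) ^ (26 * (m : ℝ)) = ((1 / X) ^ 13) ^ (2 * m) := by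
      rw [← pow_mul, ← Real.rpow_natCast]; congr 1; push_cast; ring
    rw [this]
    exact pow_le_pow_left₀ (by positivity) b1 _
  have c2 : (1 / X) ^ ((31 + s) * K * k) ≤ (lam / 60 / (2 ^ 22 * CR * d ^ 3 * m)) ^ d := by
    calc (1 / X) ^ ((31 + s) * K * k) ≤ (1 / X) ^ ((31 + s) * d) := by
          refine Real.rpow_le_rpow_of_exponent_ge hXinv hXinv1 ?_
          rw [mul_assoc]; gcongr
      _ = ((1 / X) ^ (31 + s)) ^ d := by
          rw [← Real.rpow_natCast, ← Real.rpow_mul hXinv.le]; push_cast; rfl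
      _ ≤ _ := Real.rpow_le_rpow (by positivity) b2 hd0.le
  calc (1 / X) ^ (C' * ((k : ℝ) + m)) ≤ (1 / X) ^ (26 * (m : ℝ) + (31 + s) * K * k) := by
        refine Real.rpow_le_rpow_of_exponent_ge hXinv hXinv1 ?_
        have h1 : (26 + (31 + s) * K) * ((k : ℝ) + m) ≤ C' * ((k : ℝ) + m) := by gcongr
        have h2 : 0 ≤ 26 * (k : ℝ) + (31 + s) * K * m := by positivity
        linarith
    _ = (1 / X) ^ (26 * (m : ℝ)) * (1 / X) ^ ((31 + s) * K * k) := Real.rpow_add hXinv _ _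
    _ ≤ _ := by gcongr

theorem Real.log_two_le_log_two_mul_inv {x : ℝ} (h0 : 0 < x) (h1 : x ≤ 1) :
    Real.log 2 ≤ Real.log (2 * x⁻¹) := by
  refine Real.log_le_log two_pos ?_
  have := one_le_inv_iff₀.2 ⟨h0, h1⟩
  linarith

/-- The choice of the moment, the number of smoothing steps, the number of samples and the rank. -/
theorem exists_parameters {lam al sig : ℝ} (hl0 : 0 < lam) (hl1 : lam ≤ 1) (ha0 : 0 < al)
    (ha1 : al ≤ 1) (hs0 : 0 < sig) (hs1 : sig ≤ 1) :
    ∃ p l n m : ℕ, 0 < p ∧ 0 < l ∧ 0 < n ∧ 0 < m ∧ 4 / al ≤ 3 ^ p ∧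
      (1 / 4 : ℝ) ^ l ≤ lam * al / 40 ∧ 28800 * p * (l : ℝ) ^ 2 / lam ^ 2 ≤ n ∧ lam⁻¹ ≤ m ∧
      8 * (Real.log 8 + n * Real.log (2 * sig⁻¹)) < m ∧
      (m : ℝ) ≤ 300000000 * (lam⁻¹ ^ 2 * Real.log (2 * lam⁻¹ * al⁻¹) ^ 2 *
        Real.log (2 * al⁻¹) * Real.log (2 * sig⁻¹)) := by
  set a := Real.log (2 * al⁻¹) with hadef
  set b := Real.log (2 * lam⁻¹ * al⁻¹) with hbdef
  set s := Real.log (2 * sig⁻¹) with hsdef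
  have l2 := Real.log_two_gt_d9
  have l2' := Real.log_two_lt_d9
  have hla0 : 0 < lam * al := by positivity
  have hla1 : lam * al ≤ 1 := mul_le_one₀ hl1 ha0.le ha1
  have ha : Real.log 2 ≤ a := Real.log_two_le_log_two_mul_inv ha0 ha1
  have hb : Real.log 2 ≤ b := by
    rw [hbdef, mul_assoc, ← mul_inv]
    exact Real.log_two_le_log_two_mul_inv hla0 hla1
  have hs : Real.log 2 ≤ s := Real.log_two_le_log_two_mul_inv hs0 hs1
  have ha' : 2 / 3 ≤ a := by linarith
  have hb' : 2 / 3 ≤ b := by linarith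
  have hs' : 2 / 3 ≤ s := by linarith
  have hli : 1 ≤ lam⁻¹ := one_le_inv_iff₀.2 ⟨hl0, hl1⟩
  have e1 : Real.log (4 / al) = Real.log 2 + a := by
    rw [hadef, ← Real.log_mul (by norm_num) (by positivity)]; congr 1; field_simp; norm_num
  have e2 : Real.log (40 / (lam * al)) ≤ 5 * Real.log 2 + b := by
    have : Real.log (40 / (lam * al)) = Real.log 20 + b := by
      rw [hbdef, ← Real.log_mul (by norm_num) (by positivity)]; congr 1; field_simp; norm_num
    rw [this]
    have h1 : Real.log 20 ≤ Real.log (2 ^ 5) := Real.log_le_log (by norm_num) (by norm_num)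
    rw [Real.log_pow] at h1
    push_cast at h1
    linarith
  have h40 : 1 < 40 / (lam * al) := by rw [lt_div_iff₀ hla0]; linarith
  have h4 : 1 < 4 / al := by rw [lt_div_iff₀ ha0]; linarith
  set p := ⌈Real.log (4 / al)⌉₊ with hp
  set l := ⌈Real.log (40 / (lam * al))⌉₊ with hl
  have hp0 : 0 < p := Nat.ceil_pos.2 (Real.log_pos h4)
  have hlpos : 0 < l := Nat.ceil_pos.2 (Real.log_pos h40)
  have hp1 : (1 : ℝ) ≤ p := by exact_mod_cast hp0
  have hlr1 : (1 : ℝ) ≤ l := by exact_mod_cast hlpos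
  have hpup : (p : ℝ) ≤ 4 * a := by
    have := Nat.ceil_lt_add_one (Real.log_pos h4).le
    rw [← hp, e1] at this
    linarith
  have hlup : (l : ℝ) ≤ 8 * b := by
    have := Nat.ceil_lt_add_one (Real.log_pos h40).le
    rw [← hl] at this
    linarith
  have hQ0 : 0 < 28800 * p * (l : ℝ) ^ 2 / lam ^ 2 := by positivity
  set n := ⌈28800 * p * (l : ℝ) ^ 2 / lam ^ 2⌉₊ with hn
  have hn0 : 0 < n := Nat.ceil_pos.2 hQ0
  have hn1 : (1 : ℝ) ≤ n := by exact_mod_cast hn0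
  have hnlow : 28800 * p * (l : ℝ) ^ 2 / lam ^ 2 ≤ n := Nat.le_ceil _
  have hq : 28800 * p * (l : ℝ) ^ 2 / lam ^ 2 = 28800 * (lam⁻¹ ^ 2 * ((l : ℝ) ^ 2 * p)) := by
    field_simp
  have hli2 : lam⁻¹ ≤ lam⁻¹ ^ 2 := le_self_pow₀ hli two_ne_zero
  have hlp : 1 ≤ (l : ℝ) ^ 2 * p := by
    have : (1 : ℝ) ≤ (l : ℝ) ^ 2 := one_le_pow₀ hlr1
    nlinarith
  have hnlam : lam⁻¹ ≤ n := by
    refine le_trans ?_ hnlow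
    rw [hq]
    have : lam⁻¹ ^ 2 * 1 ≤ lam⁻¹ ^ 2 * ((l : ℝ) ^ 2 * p) := by gcongr
    nlinarith
  have hnup : (n : ℝ) ≤ 28801 * (256 * (lam⁻¹ ^ 2 * (b ^ 2 * a))) := by
    have h1 := Nat.ceil_lt_add_one hQ0.le
    rw [← hn, hq] at h1
    have h2 : lam⁻¹ ^ 2 * ((l : ℝ) ^ 2 * p) ≤ 256 * (lam⁻¹ ^ 2 * (b ^ 2 * a)) := by
      calc lam⁻¹ ^ 2 * ((l : ℝ) ^ 2 * p) ≤ lam⁻¹ ^ 2 * ((8 * b) ^ 2 * (4 * a)) := by gcongr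
        _ = _ := by ring
    have h3 : 1 ≤ lam⁻¹ ^ 2 * ((l : ℝ) ^ 2 * p) := by
      have : (1 : ℝ) ≤ lam⁻¹ ^ 2 := one_le_pow₀ hli
      nlinarith
    linarith
  have hmpos : 0 ≤ 32 * n * s := by positivity
  have hmlt := Nat.lt_floor_add_one (32 * n * s)
  have hmle := Nat.floor_le hmpos
  -- 8 log 8 = 24 log 2 ≤ 24 n s, which together with 8 n s gives 32 n s. Adding 1 to the floor
  -- makes the inequality strict.
  refine ⟨p, l, n, ⌊32 * n * s⌋₊ + 1, hp0, hlpos, hn0, Nat.succ_pos _, ?_, ?_, hnlow, ?_, ?_, ?_⟩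
  · have h1 : Real.log (4 / al) ≤ p * 1 := by rw [mul_one]; exact Nat.le_ceil _
    rw [Real.log_le_iff_le_exp (by positivity), Real.exp_nat_mul] at h1
    refine h1.trans (pow_le_pow_left₀ (Real.exp_pos _).le ?_ _)
    linarith [Real.exp_one_lt_d9]
  · have h1 : Real.log (40 / (lam * al)) ≤ l * 1 := by rw [mul_one]; exact Nat.le_ceil _
    rw [Real.log_le_iff_le_exp (by positivity), Real.exp_nat_mul] at h1
    have h2 : 40 / (lam * al) ≤ (4 : ℝ) ^ l := by
      refine h1.trans (pow_le_pow_left₀ (Real.exp_pos _).le ?_ _)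
      linarith [Real.exp_one_lt_d9]
    rw [div_pow, one_pow]
    have h3 := one_div_le_one_div_of_le (by positivity) h2
    rwa [one_div_div] at h3
  · push_cast
    have : (n : ℝ) * 1 ≤ n * (32 * s) := by gcongr; linarith
    linarith
  · push_cast
    have h8 : Real.log 8 = 3 * Real.log 2 := by
      rw [show (8 : ℝ) = 2 ^ 3 by norm_num, Real.log_pow]; push_cast; rfl
    have h9 : s ≤ n * s := le_mul_of_one_le_left (by linarith) hn1
    rw [h8]
    linarith
  · push_cast
    have h9 : s ≤ n * s := le_mul_of_one_le_left (by linarith) hn1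
    have h1 : 1 ≤ 2 * (n * s) := by linarith
    have h2 : (n : ℝ) * s ≤ 28801 * (256 * (lam⁻¹ ^ 2 * (b ^ 2 * a))) * s := by gcongr
    have h3 : lam⁻¹ ^ 2 * b ^ 2 * a * s = lam⁻¹ ^ 2 * (b ^ 2 * a) * s := by ring
    have h4 : 0 ≤ lam⁻¹ ^ 2 * (b ^ 2 * a) * s := by positivity
    rw [h3]
    linarith

/-- The factor 2r ≤ 4q is a · (4/al), absorbed into 3^p; hence p of order log(4/al). What remains is
18p/n ≤ (lam/(40 l))², and 18 · 40² = 28800. -/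
theorem moment_condition {a q lam al E : ℝ} {p l n : ℕ} {r : ℝ} (hp : 0 < p) (hl : 0 < l)
    (hn : 0 < n) (hl0 : 0 < lam) (ha0 : 0 < al) (ha : a = al * q) (hq : 0 < q)
    (hr : r ≤ 2 * q) (hE : E = lam * a / (40 * l)) (h3 : 4 / al ≤ 3 ^ p)
    (hnl : 28800 * p * (l : ℝ) ^ 2 / lam ^ 2 ≤ n) :
    a ^ (2 * p - 1) * (2 * r * (6 * p / n) ^ p) ≤ E ^ (2 * p) := by
  have hn0 : (0 : ℝ) < n := Nat.cast_pos.2 hn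
  have hl' : (0 : ℝ) < l := Nat.cast_pos.2 hl
  have hp0 : (0 : ℝ) < p := Nat.cast_pos.2 hp
  have haa : 0 < a := by rw [ha]; positivity
  have h1 : 2 * r ≤ a * (4 / al) := by rw [ha]; field_simp; linarith
  have h2 : 18 * p / n ≤ (lam / (40 * l)) ^ 2 := by
    rw [div_le_iff₀ (by positivity)] at hnl
    rw [div_pow, div_le_div_iff₀ hn0 (by positivity)]
    nlinarith
  calc a ^ (2 * p - 1) * (2 * r * (6 * p / n) ^ p)
      ≤ a ^ (2 * p - 1) * (a * 3 ^ p * (6 * p / n) ^ p) := by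
        have : 2 * r ≤ a * 3 ^ p := h1.trans (by gcongr)
        gcongr
    _ = a ^ (2 * p) * (18 * p / n) ^ p := by
        have : a ^ (2 * p) = a ^ (2 * p - 1) * a := by rw [← pow_succ]; congr 1; omega
        rw [this, mul_assoc a, ← mul_pow, mul_assoc]
        congr 3; ring
    _ ≤ a ^ (2 * p) * ((lam / (40 * l)) ^ 2) ^ p := by gcongr
    _ = E ^ (2 * p) := by
        rw [← pow_mul, ← mul_pow, hE]; congr 1; ring

/-! ### The main theorem -/

theorem mainTheorem3 :
    ∃ C₀ : ℝ, 1 < C₀ ∧ ∀ CR : ℝ, C₀ ≤ CR → ∀ K : ℝ, 1 ≤ K →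
      ∃ c C : ℝ, 0 < c ∧ c ≤ 1 ∧ 1 ≤ C ∧
        ∀ (G : Type*) [AddCommGroup G] [Fintype G] (B B' : BohrSet G) (d d' ρ' : ℝ) (k : ℕ)
          (L A S : Set G) (lam al sig : ℝ),
          1 ≤ d → B.IsRegularOfDim CR d →
          1 ≤ k → B'.rank = k →
          1 ≤ d' → d' ≤ K * k → B'.IsRegularOfDim CR d' →
          0 < ρ' → B'.carrier ⊆ B.dilate ρ' →
          L ⊆ B.carrier → lam = relDensity B.carrier L →
          A ⊆ B.carrier → al = relDensity B.carrier A →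
          S ⊆ B'.carrier → sig = relDensity B'.carrier S →
          ρ' ≤ c * lam * al / d →
            lam * sig * al / 2 ≤
                innerOn B.carrier (convOn B'.carrier (ind L) (ind S)) (ind A) ∨
              ∃ (B''' : BohrSet G) (m : ℕ),
                B'''.IsRegular CR ∧
                1 ≤ m ∧
                (m : ℝ) ≤ C * (lam⁻¹ ^ 2 * Real.log (2 * lam⁻¹ * al⁻¹) ^ 2 *
                  Real.log (2 * al⁻¹) * Real.log (2 * sig⁻¹)) ∧
                B'''.rank ≤ k + m ∧
                (1 / (2 * (k : ℝ) * (m : ℝ))) ^ (C * ((k : ℝ) + (m : ℝ))) ≤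
                  relDensity B'.carrier B'''.carrier ∧
                al * (1 + c * lam) ≤
                  supNorm (convOn B'''.carrier (ind A) (fun _ => 1)) := by
  refine ⟨128, by norm_num, fun CR hCR K hK => ?_⟩
  obtain ⟨C₁, hC₁, hsize⟩ := exists_size_exponent hCR hK
  have hCR0 : 0 < CR := by linarith
  -- This c limits the growth of `B` under dilation by 1 + 2ρ' to CR · d · 2ρ' ≤ lam/20.
  refine ⟨1 / (40 * CR), C₁ + 300000000, by positivity,
    div_le_one_of_le₀ (by linarith) (by positivity), by linarith, ?_⟩
  intro G _ _ B B' d d' ρ' k L A S lam al sig hd hB hk hrank hd' hdK hB' hρ' hsub hL hlam hA hal hS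
    hsig hρ
  classical
  lift L to Finset G using L.toFinite
  lift A to Finset G using A.toFinite
  lift S to Finset G using S.toFinite
  rw [← BohrSet.coe_ball_one] at *
  rw [← BohrSet.coe_ball_one B'] at *
  rw [← BohrSet.coe_ball, coe_subset] at hsub
  rw [coe_subset] at hL hA hS
  rw [relDensity_coe_of_subset hL] at hlam
  rw [relDensity_coe_of_subset hA] at hal
  rw [relDensity_coe_of_subset hS] at hsig
  set c : ℝ := 1 / (40 * CR) with hc
  have hB0 := B.card_ball_pos zero_le_one
  have hB0' := B'.card_ball_pos zero_le_one
  have hF0 : 0 ≤ shiftCorr (ind (L : Set G)) A S 0 := by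
    refine sum_nonneg fun x _ => div_nonneg (sum_nonneg fun z _ => ?_) (Nat.cast_nonneg _)
    rw [ind_coe]; split_ifs <;> norm_num
  rw [innerOn_convOn_eq hA hS, ← hsig]
  have hsig0 : 0 ≤ sig := by rw [hsig]; positivity
  have hlam0 : 0 ≤ lam := by rw [hlam]; positivity
  have hal0 : 0 ≤ al := by rw [hal]; positivity
  -- If some density vanishes, the first alternative only claims non-negativity.
  by_cases hzero : lam * sig * al = 0
  · left
    rw [hzero, zero_div]
    positivity
  have hl0 : 0 < lam := hlam0.lt_of_ne fun h => hzero (by rw [← h]; ring)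
  have ha0 : 0 < al := hal0.lt_of_ne fun h => hzero (by rw [← h]; ring)
  have hs0 : 0 < sig := hsig0.lt_of_ne fun h => hzero (by rw [← h]; ring)
  have hl1 : lam ≤ 1 := by
    rw [hlam]; exact div_le_one_of_le₀ (Nat.cast_le.2 (card_le_card hL)) hB0.le
  have ha1 : al ≤ 1 := by
    rw [hal]; exact div_le_one_of_le₀ (Nat.cast_le.2 (card_le_card hA)) hB0.le
  have hs1 : sig ≤ 1 := by
    rw [hsig]; exact div_le_one_of_le₀ (Nat.cast_le.2 (card_le_card hS)) hB0'.le
  have hLcard : (#L : ℝ) = lam * #(B.ball 1) := by rw [hlam, div_mul_cancel₀ _ hB0.ne']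
  have hAcard : (#A : ℝ) = al * #(B.ball 1) := by rw [hal, div_mul_cancel₀ _ hB0.ne']
  clear hlam hal
  have hSne : S.Nonempty := by
    rw [nonempty_iff_ne_empty]; rintro rfl; simp [hsig] at hs0
  obtain ⟨p, l, n, m, hp, hl, hn, hm, h3, h4, hnl, hlm, hmlog, hmC⟩ :=
    exists_parameters hl0 hl1 ha0 ha1 hs0 hs1
  have hρd : ρ' * d ≤ c * lam * al := by rwa [le_div_iff₀ (by linarith)] at hρ
  have hcCR : CR * c = 1 / 40 := by rw [hc]; field_simp
  have hla : lam * al ≤ lam := mul_le_of_le_one_right hl0.le ha1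
  have hkey : CR * d * (2 * ρ') ≤ lam / 20 := by
    calc CR * d * (2 * ρ') = 2 * CR * (ρ' * d) := by ring
      _ ≤ 2 * CR * (c * lam * al) := by gcongr
      _ = 2 * (CR * c) * (lam * al) := by ring
      _ ≤ lam / 20 := by rw [hcCR]; linarith
  -- Room for A + P - S: both `P` and `S` lie in `B'`, hence in the dilate of `B` by ρ'.
  set R := B.ball (1 + 2 * ρ') with hR
  have hRcard : (#R : ℝ) ≤ (1 + lam / 20) * #(B.ball 1) := by
    refine (hB.card_ball_le (by positivity) ?_).trans ?_
    · rw [le_div_iff₀ (by positivity)]; linarith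
    · gcongr
  have hLR : L ⊆ R := hL.trans (B.ball_mono (by linarith))
  have hfR : ∀ x ∉ R, ∀ z ∈ S, ind (L : Set G) (x - z) = 0 := by
    intro x hx z hz
    rw [ind_coe, if_neg]
    intro h
    apply hx
    have := BohrSet.add_mem_ball (hL h) (hsub (hS hz))
    rw [sub_add_cancel] at this
    exact B.ball_mono (by linarith) this
  have hE := moment_condition (r := (#R : ℝ)) hp hl hn hl0 ha0 hAcard hB0
    (hRcard.trans (by gcongr; linarith)) rfl h3 hnl
  rw [hsig] at hmlog
  obtain ⟨P, T, hPreg, hPrank, hPsub, hPcard, hT, hPspec, hTper⟩ :=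
    exists_bohrSet_of_almost_periods hCR hd' hB'
    (f := ind (L : Set G)) (A := A) (R := R)
    (fun x => by rw [ind_coe]; split_ifs <;> norm_num)
    (fun x => by rw [ind_coe]; split_ifs <;> norm_num) hSne hS hfR hn hp (by positivity) hE hmlog
    (η := lam / 60) (by positivity) (by linarith)
  by_cases hcon : al * (1 + c * lam) ≤
      supNorm (convOn P.carrier (ind (A : Set G)) (fun _ => 1))
  · refine Or.inr ⟨P, m, hPreg, hm, ?_, by rw [← hrank]; exact hPrank, ?_, hcon⟩
    · refine hmC.trans ?_
      have l1 : 0 ≤ Real.log (2 * al⁻¹) :=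
        (Real.log_nonneg one_le_two).trans (Real.log_two_le_log_two_mul_inv ha0 ha1)
      have l2 : 0 ≤ Real.log (2 * sig⁻¹) :=
        (Real.log_nonneg one_le_two).trans (Real.log_two_le_log_two_mul_inv hs0 hs1)
      gcongr
      linarith
    · rw [← BohrSet.coe_ball_one, relDensity_coe_of_subset hPsub, le_div_iff₀ hB0']
      refine le_trans ?_ hPcard
      gcongr
      exact hsize k m d' lam _ hk hm hd' hdK hl0 hl1 hlm (by linarith)
  · left
    have hκ : ∀ x, convOn (P.ball 1 : Set G) (ind (A : Set G)) (fun _ => 1) x ≤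
        al * (1 + c * lam) := by
      intro x
      rw [BohrSet.coe_ball_one]
      refine le_trans ?_ (not_le.1 hcon).le
      exact (le_abs_self _).trans (le_ciSup (f := fun x =>
        |convOn P.carrier (ind (A : Set G)) (fun _ => 1) x|) (Set.finite_range _).bddAbove x)
    have hfin := le_shiftCorr_zero (c := c) (B.ball_nonempty zero_le_one) hL hA hSne hT
      (P.ball_nonempty zero_le_one) hl0 ha0 hLcard hAcard (by positivity) (by
        rw [hc]; exact one_div_le_one_div_of_le (by norm_num) (by linarith)) hκ hLR
      (fun a ha t ht z hz => by
        have := BohrSet.sub_mem_ball (BohrSet.add_mem_ball (hA ha) (hsub (hPsub ht)))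
          (hsub (hS hz))
        exact B.ball_mono (by linarith) this) hRcard hl h4 hPspec hTper
    rw [le_div_iff₀ hB0]
    rw [hAcard] at hfin
    calc lam * sig * al / 2 * #(B.ball 1) = sig * (lam * (al * #(B.ball 1)) / 2) := by ring
      _ ≤ _ := by gcongr
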